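/- Let $K$ be a number field with ring of integers $\mathcal O_K$ and a fixed algebraic closure $\overline K$, and let $X=\{F=0\}\subset\mathbb P^3$ be a smooth quartic surface over $K$. Let $\mathcal L$ be the set of lines of $\mathbb P^3_{\overline K}$ contained in $X$. A *scheme of lines* on $X$ is a pair $(\mathcal S,\eta)$ of a finite ($0$-dimensional) reduced $K$-scheme $\mathcal S$ and a $\mathrm{Gal}(\overline K/K)$-equivariant bijection $\eta:\mathcal S(\overline K)\to\mathcal L$. For a set $L$ of lines in $\mathbb P^3$ over an algebraically closed field, let $\mathcal G(L)$ be the bipartite graph whose vertices are the lines in $L$ and the intersection points of pairs of distinct lines in $L$, and whose edges are the incident pairs (point, line). Put $\mathcal G(\mathcal S,\eta)=\mathcal G(\mathrm{im}\,\eta)$. Let $\mathfrak p$ be a maximal ideal of $\mathcal O_K$ and $\mathbb F_{\mathfrak p}=\mathcal O_K/\mathfrak p$. Given a place of $\overline K$ above $\mathfrak p$ (a valuation ring of $\overline K$ whose maximal ideal meets $\mathcal O_K$ in $\mathfrak p$), with residue field $\overline{\mathbb F_{\mathfrak p}}$, let $r_{\mathfrak p}$ denote the reduction of points and lines of $\mathbb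 P^3$, and of $\overline K$-points of a finite $K$-scheme with a given finite integral model over $\mathcal O_K$; let $\mathcal L_{\mathfrak p}=r_{\mathfrak p}(\mathcal L)$. We say that $(\mathcal S,\eta)$ *has good reduction at $\mathfrak p$* if $\mathcal S$ has a finite flat integral model over $\mathcal O_K$ that is smooth over the localization $(\mathcal O_K)_{\mathfrak p}$, with fibre $\mathcal S_{\mathfrak p}$ over $\mathbb F_{\mathfrak p}$, such that for every place of $\overline K$ above $\mathfrak p$: * $X$ has good reduction: some nonzero multiple of $F$ has coefficients in $\mathcal O_K$, and its reduction modulo $\mathfrak p$ defines a smooth quartic surface; * there is an injective map $\eta_{\mathfrak p}:\mathcal S_{\mathfrak p}(\overline{\mathbb F_{\mathfrak p}})\to\mathcal L_{\mathfrak p}$, equivariant under $\mathrm{Gal}(\overline{\mathbb F_{\mathfrak p}}/\mathbb F_{\mathfrak p})$, with $r_{\mathfrak p}\circ\eta=\eta_{\mathfrak p}\circ r_{\mathfrak p}$ on $\mathcal S(\overline K)$; * the map $r_{\mathfrak p}$ on points and lines induces an isomorphism of bipartite graphs $\mathcal G(\mathcal S,\eta)\cong\mathcal G(\mathcal S_{\mathfrak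 p},\eta_{\mathfrak p})$, where $\mathcal G(\mathcal S_{\mathfrak p},\eta_{\mathfrak p})=\mathcal G(\mathrm{im}\,\eta_{\mathfrak p})$. **Proposition.** A scheme of lines on $X$ exists. For every scheme of lines $(\mathcal S,\eta)$ on $X$ there is a positive integer $D$ such that for every prime number $p\nmid D$ and every maximal ideal $\mathfrak p$ of $\mathcal O_K$ containing $p$, the scheme of lines $(\mathcal S,\eta)$ has good reduction at $\mathfrak p$. In particular, the incidence graph of the lines on $X$ and their intersection points is preserved by reduction modulo $\mathfrak p$. -/

import Mathlib

open scoped NumberField TensorProduct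

namespace LinesOnQuartic

universe u v w

/-! ### Smooth quartics in projective 3-space and their lines

Points and lines of `ℙ³` over a field `Ω` are the linear subspaces of `Ω⁴` of dimension `1`
and `2` respectively. -/

/-- `F` is homogeneous of degree `4` over `k` and `{F = 0} ⊆ ℙ³` is smooth over `k`: by the Jacobian
criterion, over the algebraically closed extension `Ω` of `k`, the form `F` and its
partial derivatives have no common zero in `ℙ³(Ω)`. -/
def IsSmoothQuartic {k : Type u} [CommRing k] (F : MvPolynomial (Fin 4) k)
    (Ω : Type v) [Field Ω] [Algebra k Ω] : Prop :=
  F.IsHomogeneous 4 ∧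
    ∀ x : Fin 4 → Ω, x ≠ 0 → MvPolynomial.aeval x F = 0 →
      ∃ i, MvPolynomial.aeval x (MvPolynomial.pderiv i F) ≠ 0

/-- The set `𝓛` of lines of `ℙ³(Ω)` that lie on the surface `F = 0`. -/
def linesOn {k : Type u} [CommRing k] (F : MvPolynomial (Fin 4) k)
    (Ω : Type v) [Field Ω] [Algebra k Ω] : Set (Submodule Ω (Fin 4 → Ω)) :=
  {W | Module.finrank Ω W = 2 ∧ ∀ x ∈ W, MvPolynomial.aeval x F = 0}

/-- The points of `ℙ³(Ω)` at which two distinct members of a set `L` of lines meet. -/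
def intersectionPoints {Ω : Type v} [Field Ω] (L : Set (Submodule Ω (Fin 4 → Ω))) :
    Set (Submodule Ω (Fin 4 → Ω)) :=
  {q | Module.finrank Ω q = 1 ∧ ∃ l₁ ∈ L, ∃ l₂ ∈ L, l₁ ≠ l₂ ∧ q = l₁ ⊓ l₂}

/-- The bipartite incidence graph of a set `L` of lines: the vertices are the intersection points
of pairs of lines of `L` and the lines of `L`; the edges join `q` to `l` when `q ∈ l`. -/
def incidenceGraph {Ω : Type v} [Field Ω] (L : Set (Submodule Ω (Fin 4 → Ω))) :
    SimpleGraph (intersectionPoints L ⊕ L) where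
  Adj a b := match a, b with
    | .inl q, .inr l => q.1 ≤ l.1
    | .inr l, .inl q => q.1 ≤ l.1
    | _, _ => False
  symm := ⟨by rintro (a | a) (b | b) h <;> exact h⟩
  loopless := ⟨by rintro (a | a) h <;> exact h⟩

/-- A map `η` from the `Ω`-points of `Spec B` to linear subspaces of `Ω⁴` commutes with the
automorphisms `σ` of `Ω` over `k`: `η (σ ∘ p) = σ (η p)`. -/
def IsEquivariant {k : Type u} [CommRing k] {Ω : Type v} [Field Ω] [Algebra k Ω]
    {B : Type w} [CommRing B] [Algebra k B]
    (η : (B →ₐ[k] Ω) → Submodule Ω (Fin 4 → Ω)) : Prop :=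
  ∀ (σ : Ω ≃ₐ[k] Ω) (p : B →ₐ[k] Ω) (x : Fin 4 → Ω),
    (fun i => σ (x i)) ∈ η ((σ : Ω →ₐ[k] Ω).comp p) ↔ x ∈ η p

/-- The pair `(𝒮, η)`: a finite (zero-dimensional) reduced `K`-scheme `𝒮 = Spec B`, whose set of
geometric points is `𝒮(K̄) = (B →ₐ[K] K̄)`, together with a map `η : 𝒮(K̄) → 𝓛` by which `𝒮`
parametrizes the lines on the surface `F = 0`. -/
structure SchemeOfLines {K : Type u} [Field K] (F : MvPolynomial (Fin 4) K)
    (Kbar : Type v) [Field Kbar] [Algebra K Kbar] where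
  /-- the coordinate ring of `𝒮` -/
  B : Type u
  [commRing : CommRing B]
  [algebra : Algebra K B]
  [finite : Module.Finite K B]
  [isReduced : IsReduced B]
  /-- the map from geometric points to lines -/
  η : (B →ₐ[K] Kbar) → Submodule Kbar (Fin 4 → Kbar)
  bijOn : Set.BijOn η Set.univ (linesOn F Kbar)
  equivariant : IsEquivariant η

attribute [instance] SchemeOfLines.commRing SchemeOfLines.algebra SchemeOfLines.finite
  SchemeOfLines.isReduced

/-! ### Places of the algebraic closure and reduction -/

/-- A place of `K̄` above the prime `𝔭` of `𝓞 K`: a valuation ring of `K̄` whose maximal ideal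
(the set of its nonunits) meets `𝓞 K` in `𝔭`. Its residue field is an algebraic closure of
`𝓞 K ⧸ 𝔭`. -/
structure PlaceOver {K : Type u} [Field K] (Kbar : Type v) [Field Kbar] [Algebra K Kbar]
    (𝔭 : Ideal (𝓞 K)) where
  ring : ValuationSubring Kbar
  mem_iff : ∀ x : 𝓞 K, algebraMap (𝓞 K) Kbar x ∈ ring.nonunits ↔ x ∈ 𝔭

theorem mem_of_isIntegral {E : Type v} [Field E] (A : ValuationSubring E) {x : E}
    (hx : IsIntegral ℤ x) : x ∈ A := by
  have h : IsIntegral A x := hx.tower_top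
  obtain ⟨y, hy⟩ := IsIntegrallyClosed.isIntegral_iff.mp h
  exact hy ▸ y.2

/-- There is a place above every prime. -/
theorem PlaceOver.nonempty {K : Type u} [Field K] {Kbar : Type v} [Field Kbar] [Algebra K Kbar]
    (𝔭 : Ideal (𝓞 K)) [𝔭.IsPrime] : Nonempty (PlaceOver Kbar 𝔭) := by
  have hinj : Function.Injective (algebraMap (𝓞 K) Kbar) := by
    rw [IsScalarTower.algebraMap_eq (𝓞 K) K Kbar]
    exact (algebraMap K Kbar).injective.comp NumberField.RingOfIntegers.coe_injective
  have hu : ∀ y : 𝔭.primeCompl, IsUnit (algebraMap (𝓞 K) Kbar y) := fun y =>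
    isUnit_iff_ne_zero.mpr fun h => y.2 (by
      rw [(injective_iff_map_eq_zero _).mp hinj _ h]; exact 𝔭.zero_mem)
  let f : Localization.AtPrime 𝔭 →+* Kbar := IsLocalization.lift hu
  have hf : ∀ x, f (algebraMap _ _ x) = algebraMap (𝓞 K) Kbar x := fun x => IsLocalization.lift_eq hu x
  obtain ⟨V, hle, hloc⟩ := (LocalSubring.range f).exists_le_valuationSubring
  have hmem : ∀ x, f x ∈ V := fun x => hle ⟨x, rfl⟩
  refine ⟨⟨V, fun x => ?_⟩⟩
  rw [ValuationSubring.mem_nonunits_iff_or]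
  constructor
  · intro h
    by_contra hx
    rcases h with h | h
    · exact hx ((injective_iff_map_eq_zero _).mp hinj _ h ▸ 𝔭.zero_mem)
    · apply h
      obtain ⟨y, hy⟩ := IsLocalization.map_units (Localization.AtPrime 𝔭) (⟨x, hx⟩ : 𝔭.primeCompl)
      have h1 : f ↑y⁻¹ = (algebraMap (𝓞 K) Kbar x)⁻¹ := by
        rw [← hf x]; apply eq_inv_of_mul_eq_one_left; rw [← map_mul, ← hy]; simp
      exact h1 ▸ hmem _
  · intro hx
    by_cases h0 : algebraMap (𝓞 K) Kbar x = 0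
    · exact .inl h0
    refine .inr fun hV => ?_
    have hun := hloc.1 ⟨algebraMap (𝓞 K) Kbar x, algebraMap _ _ x, hf x⟩
      (isUnit_iff_exists_inv.mpr ⟨⟨_, hV⟩, Subtype.ext (mul_inv_cancel₀ h0)⟩)
    obtain ⟨⟨_, z, rfl⟩, hz⟩ := isUnit_iff_exists_inv.mp hun
    have hz' : algebraMap (𝓞 K) Kbar x * f z = 1 := congrArg Subtype.val hz
    obtain ⟨a, s, rfl⟩ := IsLocalization.exists_mk'_eq 𝔭.primeCompl z
    have : algebraMap (𝓞 K) Kbar (x * a) = algebraMap (𝓞 K) Kbar s := by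
      have h2 := IsLocalization.mk'_spec (Localization.AtPrime 𝔭) a s
      have h3 := congrArg f h2
      rw [map_mul, hf, hf] at h3
      rw [map_mul, ← h3, ← mul_assoc, hz', one_mul]
    exact s.2 (hinj this ▸ 𝔭.mul_mem_right a hx)

section Place

variable {K : Type u} [Field K] {Kbar : Type v} [Field Kbar] [Algebra K Kbar] {𝔭 : Ideal (𝓞 K)}

theorem mem_of_isIntegral_ringOfIntegers (A : ValuationSubring Kbar) {x : Kbar}
    (hx : IsIntegral (𝓞 K) x) : x ∈ A :=
  mem_of_isIntegral A (isIntegral_trans (R := ℤ) (A := 𝓞 K) x hx)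

/-- The residue field `k` of the place. -/
abbrev PlaceOver.Residue (P : PlaceOver Kbar 𝔭) : Type v := IsLocalRing.ResidueField P.ring

instance PlaceOver.algebraRing (P : PlaceOver Kbar 𝔭) : Algebra (𝓞 K) P.ring :=
  ((algebraMap (𝓞 K) Kbar).codRestrict P.ring
    (fun _ => mem_of_isIntegral_ringOfIntegers P.ring isIntegral_algebraMap)).toAlgebra

theorem PlaceOver.algebraMap_eq_zero (P : PlaceOver Kbar 𝔭) (x : 𝓞 K) (hx : x ∈ 𝔭) :
    algebraMap (𝓞 K) P.Residue x = 0 := by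
  have h := (P.mem_iff x).mpr hx
  rw [IsScalarTower.algebraMap_apply (𝓞 K) P.ring P.Residue, IsLocalRing.ResidueField.algebraMap_eq,
    IsLocalRing.residue_eq_zero_iff]
  exact (ValuationSubring.mem_nonunits_iff_exists_mem_maximalIdeal.mp h).2

/-- The inclusion of the residue field `𝓞 K ⧸ 𝔭` of `𝔭` in the residue field of the place. -/
noncomputable instance PlaceOver.algebraResidue (P : PlaceOver Kbar 𝔭) : Algebra (𝓞 K ⧸ 𝔭) P.Residue :=
  (Ideal.Quotient.lift 𝔭 (algebraMap (𝓞 K) P.Residue) P.algebraMap_eq_zero).toAlgebra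

instance PlaceOver.isScalarTower (P : PlaceOver Kbar 𝔭) :
    IsScalarTower (𝓞 K) (𝓞 K ⧸ 𝔭) P.Residue :=
  IsScalarTower.of_algebraMap_eq fun _ => rfl

/-- The reduction map `r_𝔭` on linear subspaces `W` of `K̄⁴` (points and lines of `ℙ³`): the
residues of the vectors of `W` whose coordinates belong to the valuation ring. -/
noncomputable def PlaceOver.reduce (P : PlaceOver Kbar 𝔭) (W : Submodule Kbar (Fin 4 → Kbar)) :
    Submodule P.Residue (Fin 4 → P.Residue) where
  carrier := {y | ∃ x : Fin 4 → P.ring,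
    (fun i => (x i : Kbar)) ∈ W ∧ y = fun i => IsLocalRing.residue P.ring (x i)}
  add_mem' := by
    rintro _ _ ⟨x, hx, rfl⟩ ⟨x', hx', rfl⟩
    exact ⟨x + x', W.add_mem hx hx', by ext i; simp⟩
  zero_mem' := ⟨0, W.zero_mem, by ext i; simp⟩
  smul_mem' := by
    rintro c _ ⟨x, hx, rfl⟩
    obtain ⟨a, rfl⟩ := IsLocalRing.residue_surjective c
    exact ⟨a • x, W.smul_mem (a : Kbar) hx, by ext i; simp⟩

end Place

/-! ### Integral models of a finite scheme -/

/-- An integral model over `𝓞 K` of the finite `K`-scheme `Spec B`: the spectrum of an order of `B`,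
that is, of a finite `𝓞 K`-subalgebra of `B` which generates `B` over `K`. -/
structure IntegralModel (K : Type u) [Field K] (B : Type w) [CommRing B] [Algebra K B] where
  order : Subalgebra (𝓞 K) B
  finite : Module.Finite (𝓞 K) order
  span_eq_top : Submodule.span K (order : Set B) = ⊤

section Model

variable {K : Type u} [Field K] {B : Type w} [CommRing B] [Algebra K B]

/-- The morphism induced by the model over the localization of `𝓞 K` at `𝔭` is smooth. -/
def IntegralModel.IsSmoothAt (M : IntegralModel K B) (𝔭 : Ideal (𝓞 K)) [𝔭.IsPrime] : Prop :=
  Algebra.Smooth (Localization.AtPrime 𝔭) (Localization.AtPrime 𝔭 ⊗[𝓞 K] M.order)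

/-- The coordinate ring of the fibre `𝒮_𝔭` of the model over `𝓞 K ⧸ 𝔭`. -/
abbrev IntegralModel.Fibre (M : IntegralModel K B) (𝔭 : Ideal (𝓞 K)) : Type (max u w) :=
  (𝓞 K ⧸ 𝔭) ⊗[𝓞 K] M.order

variable {Kbar : Type v} [Field Kbar] [Algebra K Kbar] {𝔭 : Ideal (𝓞 K)}

theorem IntegralModel.isIntegral_apply (M : IntegralModel K B) (p : B →ₐ[K] Kbar) (b : M.order) :
    IsIntegral (𝓞 K) (p b) := by
  have := M.finite
  have h : IsIntegral (𝓞 K) b := Algebra.IsIntegral.isIntegral b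
  exact h.map ((p.restrictScalars (𝓞 K)).comp M.order.val)

/-- The restriction of a geometric point `p : B → K̄` to the order, with values in the valuation
ring. -/
noncomputable def IntegralModel.restrict (M : IntegralModel K B) (P : PlaceOver Kbar 𝔭)
    (p : B →ₐ[K] Kbar) : M.order →ₐ[𝓞 K] P.ring where
  toFun b := ⟨p b, mem_of_isIntegral_ringOfIntegers P.ring (M.isIntegral_apply p b)⟩
  map_one' := Subtype.ext (by simp)
  map_mul' _ _ := Subtype.ext (by simp)
  map_zero' := Subtype.ext (by simp)
  map_add' _ _ := Subtype.ext (by simp)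
  commutes' r := Subtype.ext ((p.restrictScalars (𝓞 K)).commutes r)

/-- The reduction map `r_𝔭 : 𝒮(K̄) → 𝒮_𝔭(k)` on geometric points: the point `p` is sent to the
point `a ⊗ b ↦ a · (residue of p b)`. -/
noncomputable def IntegralModel.reducePoint (M : IntegralModel K B) (P : PlaceOver Kbar 𝔭)
    (p : B →ₐ[K] Kbar) : M.Fibre 𝔭 →ₐ[𝓞 K ⧸ 𝔭] P.Residue :=
  Algebra.TensorProduct.lift (Algebra.ofId (𝓞 K ⧸ 𝔭) P.Residue)
    ((IsScalarTower.toAlgHom (𝓞 K) P.ring P.Residue).comp (M.restrict P p))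
    (fun _ _ => Commute.all _ _)

end Model

/-! ### Good reduction -/

section GoodReduction

variable {K : Type u} [Field K] {Kbar : Type v} [Field Kbar] [Algebra K Kbar]

/-- The surface `F = 0` has good reduction at the place: up to a nonzero constant, `F` is the
generic fibre of a quartic form over `𝓞 K` whose reduction modulo `𝔭` is a smooth quartic. -/
def QuarticGoodReduction (F : MvPolynomial (Fin 4) K) {𝔭 : Ideal (𝓞 K)} (P : PlaceOver Kbar 𝔭) :
    Prop :=
  ∃ (G : MvPolynomial (Fin 4) (𝓞 K)) (c : K), c ≠ 0 ∧
    MvPolynomial.map (algebraMap (𝓞 K) K) G = MvPolynomial.C c * F ∧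
    IsSmoothQuartic (MvPolynomial.map (Ideal.Quotient.mk 𝔭) G) P.Residue

/-- The scheme of lines `(𝒮, η)` on `F = 0` has good reduction at `𝔭`: there is an integral model of
`𝒮` which is smooth at `𝔭` and, for every place above `𝔭` (that is, for every choice of the
reduction map `r_𝔭`), the surface has good reduction and there is an injective map
`η_𝔭 : 𝒮_𝔭(k) → 𝓛_𝔭 = r_𝔭(𝓛)`, compatible with the automorphisms of `k` over `𝓞 K ⧸ 𝔭`,
such that `r_𝔭 ∘ η = η_𝔭 ∘ r_𝔭`, and `r_𝔭` induces an isomorphism of bipartite graphs from the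
incidence graph of `(𝒮, η)` to that of `(𝒮_𝔭, η_𝔭)`. -/
def SchemeOfLines.HasGoodReductionAt {F : MvPolynomial (Fin 4) K} (S : SchemeOfLines F Kbar)
    (𝔭 : Ideal (𝓞 K)) [𝔭.IsMaximal] : Prop :=
  ∃ M : IntegralModel K S.B, M.IsSmoothAt 𝔭 ∧
    ∀ P : PlaceOver Kbar 𝔭,
      QuarticGoodReduction F P ∧
      ∃ η' : (M.Fibre 𝔭 →ₐ[𝓞 K ⧸ 𝔭] P.Residue) → Submodule P.Residue (Fin 4 → P.Residue),
        (∀ q, η' q ∈ P.reduce '' linesOn F Kbar) ∧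
        Function.Injective η' ∧
        IsEquivariant η' ∧
        (∀ p : S.B →ₐ[K] Kbar, P.reduce (S.η p) = η' (M.reducePoint P p)) ∧
        ∃ φ : incidenceGraph (Set.range S.η) ≃g incidenceGraph (Set.range η'),
          (∀ q : intersectionPoints (Set.range S.η),
            ∃ q' : intersectionPoints (Set.range η'),
              φ (Sum.inl q) = Sum.inl q' ∧ q'.1 = P.reduce q.1) ∧
          (∀ l : Set.range S.η,
            ∃ l' : Set.range η', φ (Sum.inr l) = Sum.inr l' ∧ l'.1 = P.reduce l.1)

end GoodReduction

end LinesOnQuartic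

/-!
For a linear subspace `W` of `Ω⁴` choose a set `s` of coordinates that restricts to an isomorphism
`W ≃ Ω^s`; the basis of `W` dual to these coordinates is canonical, hence it is permuted by field
automorphisms, and at every place where its entries are integral it reduces to the basis of the
same kind of the reduction of `W`. Each property of finitely many subspaces (dimensions, sums,
intersections, incidences) is therefore preserved by reduction at all the valuation rings that
contain suitable finitely many elements of `K̄`, and such elements become integral after
multiplication by a single positive integer `D`.

There are finitely many lines on `X`: the lines with a given `s` are the points of an affine
scheme, and this scheme is unramified because a first-order deformation of a line in a smooth
surface of degree at least `3` is trivial. A generic linear form in the entries of the canonical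
bases separates the lines equivariantly, so the lines are the roots of a separable polynomial over
`K`, whose root scheme is a scheme of lines.

Any scheme of lines has a model `𝓞 K[θ] ≃ 𝓞 K[T]/(f)`, which is étale away from the discriminant of
`f`, where its geometric points reduce bijectively. Equivariant functions on the geometric points
are values of elements of `B`, hence of the model after multiplication by a constant, so their
residues are equivariant for the automorphisms of the residue field; applied to the entries of the
canonical bases, this gives the equivariance of `η_𝔭`.

Smoothness of the reduced quartic is the Nullstellensatz: powers of the coordinates, multiplied by
nonzero constants of `𝓞 K`, lie in the ideal generated by `F` and its partial derivatives.
-/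

namespace LinesOnQuartic

universe u v w

section Frame

variable {Ω ι : Type*} [Field Ω] [DecidableEq ι]

/-- The reduced echelon basis `(b j)_{j ∈ s}` of a subspace `W` of `Ω^ι` with pivot set `s`: on `W`
a vector is determined by its coordinates in `s`, and `b j` is the vector of `W` whose coordinates
in `s` are those of the `j`-th unit vector. For `j ∉ s` this forces `b j = 0`, so that `b` is
determined by `W` and `s`. -/
structure IsFrame (W : Submodule Ω (ι → Ω)) (s : Finset ι) (b : ι → ι → Ω) : Prop where
  mem : ∀ j, b j ∈ W
  apply : ∀ j, ∀ i ∈ s, b j i = if i = j then 1 else 0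
  eq_zero : ∀ x ∈ W, (∀ i ∈ s, x i = 0) → x = 0

namespace IsFrame

variable {W W' : Submodule Ω (ι → Ω)} {s : Finset ι} {b b' : ι → ι → Ω}

theorem sum_smul_apply (h : IsFrame W s b) (c : ι → Ω) {i : ι} (hi : i ∈ s) :
    (∑ j ∈ s, c j • b j) i = c i := by
  simp [Finset.sum_apply, h.apply _ i hi, hi]

theorem sum_smul_mem (h : IsFrame W s b) (c : ι → Ω) : ∑ j ∈ s, c j • b j ∈ W :=
  W.sum_mem fun j _ => W.smul_mem _ (h.mem j)

theorem mem_iff (h : IsFrame W s b) {x : ι → Ω} : x ∈ W ↔ ∑ j ∈ s, x j • b j = x := by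
  refine ⟨fun hx => sub_eq_zero.mp ?_, fun hx => hx ▸ h.sum_smul_mem x⟩
  refine h.eq_zero _ (W.sub_mem (h.sum_smul_mem x) hx) fun i hi => ?_
  rw [Pi.sub_apply, h.sum_smul_apply x hi, sub_self]

theorem right_unique (h : IsFrame W s b) (h' : IsFrame W s b') : b = b' := by
  funext j
  refine sub_eq_zero.mp (h.eq_zero _ (W.sub_mem (h.mem j) (h'.mem j)) fun i hi => ?_)
  rw [Pi.sub_apply, h.apply j i hi, h'.apply j i hi, sub_self]

theorem left_unique (h : IsFrame W s b) (h' : IsFrame W' s b) : W = W' :=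
  Submodule.ext fun _ => h.mem_iff.trans h'.mem_iff.symm

theorem finrank_eq (h : IsFrame W s b) : Module.finrank Ω W = s.card := by
  let coords : W →ₗ[Ω] s → Ω := (LinearMap.funLeft Ω Ω ((↑) : s → ι)).comp W.subtype
  have hinj : Function.Injective coords := (injective_iff_map_eq_zero _).mpr fun x hx =>
    Subtype.ext (h.eq_zero x x.2 fun i hi => congrFun hx ⟨i, hi⟩)
  have hsurj : Function.Surjective coords := fun y => by
    let c : ι → Ω := fun i => if hi : i ∈ s then y ⟨i, hi⟩ else 0
    refine ⟨⟨∑ j ∈ s, c j • b j, h.sum_smul_mem c⟩, funext fun i => ?_⟩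
    exact (h.sum_smul_apply c i.2).trans (dif_pos i.2)
  rw [(LinearEquiv.ofBijective coords ⟨hinj, hsurj⟩).finrank_eq, Module.finrank_pi,
    Fintype.card_coe]

theorem eq_zero_of_notMem (h : IsFrame W s b) {j : ι} (hj : j ∉ s) : b j = 0 :=
  h.eq_zero _ (h.mem j) fun i hi => by rw [h.apply j i hi, if_neg (ne_of_mem_of_not_mem hi hj)]

theorem span_range_eq (h : IsFrame W s b) : Submodule.span Ω (Set.range b) = W := by
  refine le_antisymm (Submodule.span_le.mpr (Set.range_subset_iff.mpr h.mem)) fun x hx => ?_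
  rw [← h.mem_iff.mp hx]
  exact Submodule.sum_mem _ fun j _ => Submodule.smul_mem _ _ (Submodule.subset_span ⟨j, rfl⟩)

end IsFrame

theorem isFrame_span_range {s : Finset ι} {b : ι → ι → Ω}
    (hb : ∀ j, ∀ i ∈ s, b j i = if i = j then 1 else 0) (hb0 : ∀ j ∉ s, b j = 0) :
    IsFrame (Submodule.span Ω (Set.range b)) s b where
  mem j := Submodule.subset_span ⟨j, rfl⟩
  apply := hb
  eq_zero x hx hxs := by
    have hspan : Submodule.span Ω (Set.range b) ≤
        LinearMap.eqLocus (∑ j ∈ s, (LinearMap.proj j).smulRight (b j)) LinearMap.id := by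
      rw [Submodule.span_le]
      rintro _ ⟨j, rfl⟩
      have hsum : ∑ i ∈ s, b j i • b i = b j := by
        by_cases hj : j ∈ s
        · rw [Finset.sum_eq_single_of_mem j hj fun i hi hij => by
            rw [hb j i hi, if_neg hij, zero_smul], hb j j hj, if_pos rfl, one_smul]
        · rw [hb0 j hj]
          exact Finset.sum_eq_zero fun i _ => zero_smul Ω (b i)
      simpa using hsum
    have hx' : ∑ j ∈ s, x j • b j = x := by simpa using hspan hx
    rw [← hx']
    exact Finset.sum_eq_zero fun j hj => by rw [hxs j hj, zero_smul]

/-- A minimal set of coordinates which determine the vectors of `W` is a set of pivots. -/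
theorem exists_isFrame [Finite ι] (W : Submodule Ω (ι → Ω)) : ∃ s b, IsFrame W s b := by
  have := Fintype.ofFinite ι
  obtain ⟨s, hs⟩ := exists_minimal_of_wellFoundedLT
    (fun s : Finset ι => ∀ x ∈ W, (∀ i ∈ s, x i = 0) → x = 0)
    ⟨Finset.univ, fun x _ hx => funext fun i => hx i (Finset.mem_univ i)⟩
  have hunit : ∀ j, ∃ y ∈ W, ∀ i ∈ s, y i = if i = j then 1 else 0 := fun j => by
    by_cases hj : j ∈ s
    · obtain ⟨x, hxW, hx, hx0⟩ : ∃ x ∈ W, (∀ i ∈ s.erase j, x i = 0) ∧ x ≠ 0 := by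
        have := hs.not_prop_of_lt (Finset.erase_ssubset hj)
        push Not at this
        exact this
      have hxj : x j ≠ 0 := fun h => hx0 <| hs.prop x hxW fun i hi => by
        by_cases hij : i = j
        · exact hij ▸ h
        · exact hx i (Finset.mem_erase.mpr ⟨hij, hi⟩)
      refine ⟨(x j)⁻¹ • x, W.smul_mem _ hxW, fun i hi => ?_⟩
      split_ifs with hij
      · simp [hij, hxj]
      · simp [hx i (Finset.mem_erase.mpr ⟨hij, hi⟩)]
    · exact ⟨0, W.zero_mem, fun i hi => (if_neg (ne_of_mem_of_not_mem hi hj)).symm⟩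
  choose b hbW hb using hunit
  exact ⟨s, b, hbW, hb, hs.prop⟩

variable [Finite ι]

/-- The pivots of a chosen frame of `W`. The choice depends only on the set of possible pivots, and
this makes it invariant under field automorphisms: see `pivotSet_galConj`. -/
noncomputable def pivotSet (W : Submodule Ω (ι → Ω)) : Finset ι :=
  Classical.epsilon fun s => ∃ b, IsFrame W s b

/-- The frame of `W` with pivot set `pivotSet W`. -/
noncomputable def frame (W : Submodule Ω (ι → Ω)) : ι → ι → Ω :=
  Classical.epsilon fun b => IsFrame W (pivotSet W) b

theorem isFrame_frame (W : Submodule Ω (ι → Ω)) : IsFrame W (pivotSet W) (frame W) :=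
  Classical.epsilon_spec (p := fun b => IsFrame W (pivotSet W) b)
    (Classical.epsilon_spec (p := fun s => ∃ b, IsFrame W s b) (exists_isFrame W))

theorem frame_injective : Function.Injective (frame : Submodule Ω (ι → Ω) → ι → ι → Ω) :=
  Function.LeftInverse.injective (g := fun b => Submodule.span Ω (Set.range b)) fun W =>
    (isFrame_frame W).span_range_eq

end Frame

section GaloisConjugate

variable {K Ω ι : Type*} [CommRing K] [Field Ω] [Algebra K Ω]

/-- The conjugate `σ W` of a subspace `W` of `Ω^ι` under an automorphism `σ` of `Ω`. -/
def galConj (σ : Ω ≃ₐ[K] Ω) (W : Submodule Ω (ι → Ω)) : Submodule Ω (ι → Ω) where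
  carrier := {x | (fun i => σ.symm (x i)) ∈ W}
  add_mem' hx hy := by simpa [← Pi.add_def] using W.add_mem hx hy
  zero_mem' := by simp [← Pi.zero_def]
  smul_mem' c x hx := by simpa [Pi.smul_def] using W.smul_mem (σ.symm c) hx

@[simp]
theorem mem_galConj {σ : Ω ≃ₐ[K] Ω} {W : Submodule Ω (ι → Ω)} {x : ι → Ω} :
    x ∈ galConj σ W ↔ (fun i => σ.symm (x i)) ∈ W :=
  Iff.rfl

theorem galConj_symm_galConj (σ : Ω ≃ₐ[K] Ω) (W : Submodule Ω (ι → Ω)) :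
    galConj σ.symm (galConj σ W) = W := by
  ext x
  simp

theorem IsFrame.galConj [DecidableEq ι] {W : Submodule Ω (ι → Ω)} {s : Finset ι} {b : ι → ι → Ω}
    (h : IsFrame W s b) (σ : Ω ≃ₐ[K] Ω) :
    IsFrame (galConj σ W) s fun j i => σ (b j i) where
  mem j := by simpa using h.mem j
  apply j i hi := by rw [h.apply j i hi, apply_ite σ, map_one, map_zero]
  eq_zero x hx hxs := funext fun i => by
    simpa using congrFun (h.eq_zero _ hx fun i hi => by simp [hxs i hi]) i

theorem pivotSet_galConj [DecidableEq ι] (σ : Ω ≃ₐ[K] Ω) (W : Submodule Ω (ι → Ω)) :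
    pivotSet (galConj σ W) = pivotSet W := by
  refine congrArg Classical.epsilon (funext fun s => propext ⟨?_, ?_⟩)
  · rintro ⟨b, hb⟩
    exact ⟨_, galConj_symm_galConj σ W ▸ hb.galConj σ.symm⟩
  · rintro ⟨b, hb⟩
    exact ⟨_, hb.galConj σ⟩

theorem frame_galConj [DecidableEq ι] [Finite ι] (σ : Ω ≃ₐ[K] Ω) (W : Submodule Ω (ι → Ω))
    (j i : ι) : frame (galConj σ W) j i = σ (frame W j i) := by
  have h := isFrame_frame (galConj σ W)
  rw [pivotSet_galConj] at h
  exact congrFun₂ (h.right_unique ((isFrame_frame W).galConj σ)) j i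

theorem finrank_galConj [Finite ι] (σ : Ω ≃ₐ[K] Ω) (W : Submodule Ω (ι → Ω)) :
    Module.finrank Ω (galConj σ W) = Module.finrank Ω W := by
  classical
  obtain ⟨s, b, hb⟩ := exists_isFrame W
  exact (hb.galConj σ).finrank_eq.trans hb.finrank_eq.symm

end GaloisConjugate

/-- The filter of the sets that contain every valuation ring of `Ω` to which finitely many given
elements belong. When `Ω` is algebraic over `ℚ`, its members are the sets that contain all places
of residue characteristic prime to some `D`: see `exists_forall_of_eventually_almostAllPlaces`. -/
def almostAll (Ω : Type*) [Field Ω] : Filter (ValuationSubring Ω) :=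
  ⨅ x : Ω, Filter.principal {A | x ∈ A}

section AlmostAll

variable {Ω ι : Type*} [Field Ω]

theorem eventually_mem (x : Ω) : ∀ᶠ A : ValuationSubring Ω in almostAll Ω, x ∈ A :=
  Filter.mem_iInf_of_mem x (Filter.mem_principal_self _)

theorem eventually_forall_mem {α : Type*} [Finite α] (x : α → Ω) :
    ∀ᶠ A : ValuationSubring Ω in almostAll Ω, ∀ i, x i ∈ A :=
  Filter.eventually_all.mpr fun i => eventually_mem (x i)

/-- The reduction of a linear subspace modulo the maximal ideal of a valuation ring: by definition,
`P.reduce` is `reduceAt P.ring` for a place `P`. -/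
noncomputable def reduceAt (A : ValuationSubring Ω) (W : Submodule Ω (ι → Ω)) :
    Submodule (IsLocalRing.ResidueField A) (ι → IsLocalRing.ResidueField A) where
  carrier := {y | ∃ x : ι → A,
    (fun i => (x i : Ω)) ∈ W ∧ y = fun i => IsLocalRing.residue A (x i)}
  add_mem' := by
    rintro _ _ ⟨x, hx, rfl⟩ ⟨x', hx', rfl⟩
    exact ⟨x + x', W.add_mem hx hx', by ext i; simp⟩
  zero_mem' := ⟨0, W.zero_mem, by ext i; simp⟩
  smul_mem' := by
    rintro c _ ⟨x, hx, rfl⟩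
    obtain ⟨a, rfl⟩ := IsLocalRing.residue_surjective c
    exact ⟨a • x, W.smul_mem (a : Ω) hx, by ext i; simp⟩

theorem reduceAt_mono (A : ValuationSubring Ω) {U W : Submodule Ω (ι → Ω)} (h : U ≤ W) :
    reduceAt A U ≤ reduceAt A W := by
  rintro _ ⟨x, hx, rfl⟩
  exact ⟨x, h hx, rfl⟩

theorem IsFrame.reduceAt [DecidableEq ι] {W : Submodule Ω (ι → Ω)} {s : Finset ι}
    {A : ValuationSubring Ω} {b : ι → ι → A} (h : IsFrame W s fun j i => (b j i : Ω)) :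
    IsFrame (reduceAt A W) s fun j i => IsLocalRing.residue A (b j i) where
  mem j := ⟨b j, h.mem j, rfl⟩
  apply j i hi := by
    have hb : b j i = if i = j then 1 else 0 :=
      Subtype.ext ((h.apply j i hi).trans (by split_ifs <;> rfl))
    rw [hb, apply_ite (IsLocalRing.residue A), map_one, map_zero]
  eq_zero := by
    rintro _ ⟨x, hxW, rfl⟩ hx
    funext i
    have hsum : ∑ j ∈ s, x j * b j i = x i := Subtype.ext <| by
      simpa [Finset.sum_apply] using congrFun (h.mem_iff.mp hxW) i
    rw [Pi.zero_apply, ← hsum, map_sum]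
    exact Finset.sum_eq_zero fun j hj => by simp only [map_mul, hx j hj, zero_mul]

variable [Finite ι]

theorem eventually_finrank_reduceAt (W : Submodule Ω (ι → Ω)) :
    ∀ᶠ A : ValuationSubring Ω in almostAll Ω,
      Module.finrank (IsLocalRing.ResidueField A) (reduceAt A W) = Module.finrank Ω W := by
  classical
  obtain ⟨s, b, hb⟩ := exists_isFrame W
  filter_upwards [eventually_forall_mem fun ji : ι × ι => b ji.1 ji.2] with A hA
  have h := IsFrame.reduceAt (b := fun j i => ⟨b j i, hA (j, i)⟩) hb
  rw [h.finrank_eq, hb.finrank_eq]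

theorem eventually_reduceAt_sup (U W : Submodule Ω (ι → Ω)) :
    ∀ᶠ A : ValuationSubring Ω in almostAll Ω, reduceAt A (U ⊔ W) = reduceAt A U ⊔ reduceAt A W := by
  classical
  obtain ⟨s, b, hb⟩ := exists_isFrame (U ⊔ W)
  choose u hu w hw huw using fun j => Submodule.mem_sup.mp (hb.mem j)
  filter_upwards [eventually_forall_mem fun ji : ι × ι => u ji.1 ji.2,
    eventually_forall_mem fun ji : ι × ι => w ji.1 ji.2] with A hAu hAw
  refine le_antisymm ?_ (sup_le (reduceAt_mono A le_sup_left) (reduceAt_mono A le_sup_right))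
  let u' (j i : ι) : A := ⟨u j i, hAu (j, i)⟩
  let w' (j i : ι) : A := ⟨w j i, hAw (j, i)⟩
  have hb' : IsFrame (U ⊔ W) s fun j i => ((u' j i + w' j i : A) : Ω) := by
    convert hb using 3 with j i
    exact congrFun (huw j) i
  intro y hy
  rw [← hb'.reduceAt.mem_iff.mp hy]
  refine Submodule.sum_mem _ fun j _ => Submodule.smul_mem _ _ (Submodule.mem_sup.mpr ?_)
  exact ⟨_, ⟨u' j, hu j, rfl⟩, _, ⟨w' j, hw j, rfl⟩, by ext i; simp⟩

theorem eventually_reduceAt_inf (U W : Submodule Ω (ι → Ω)) :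
    ∀ᶠ A : ValuationSubring Ω in almostAll Ω, reduceAt A (U ⊓ W) = reduceAt A U ⊓ reduceAt A W := by
  filter_upwards [eventually_reduceAt_sup U W, eventually_finrank_reduceAt U,
    eventually_finrank_reduceAt W, eventually_finrank_reduceAt (U ⊔ W),
    eventually_finrank_reduceAt (U ⊓ W)] with A hsup hU hW hUsupW hUinfW
  have hdim := Submodule.finrank_sup_add_finrank_inf_eq U W
  have hdim' := Submodule.finrank_sup_add_finrank_inf_eq (reduceAt A U) (reduceAt A W)
  rw [← hsup] at hdim'
  exact Submodule.eq_of_le_of_finrank_eq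
    (le_inf (reduceAt_mono A inf_le_left) (reduceAt_mono A inf_le_right)) (by lia)

theorem eventually_reduceAt_le_iff (U W : Submodule Ω (ι → Ω)) :
    ∀ᶠ A : ValuationSubring Ω in almostAll Ω, reduceAt A U ≤ reduceAt A W ↔ U ≤ W := by
  filter_upwards [eventually_reduceAt_inf U W, eventually_finrank_reduceAt U,
    eventually_finrank_reduceAt (U ⊓ W)] with A hinf hU hUinfW
  refine ⟨fun h => ?_, reduceAt_mono A⟩
  rw [inf_eq_left.mpr h] at hinf
  exact inf_eq_left.mp (Submodule.eq_of_le_of_finrank_eq inf_le_left (by rw [← hUinfW, hinf, hU]))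

end AlmostAll

section Places

variable {K : Type u} [Field K] {Kbar : Type v} [Field Kbar] [Algebra K Kbar]

variable (K Kbar) in
/-- The places of `Kbar`, each bundled with the ideal of `𝓞 K` below it. -/
abbrev Place := Σ 𝔭 : Ideal (𝓞 K), PlaceOver Kbar 𝔭

variable (K Kbar) in
/-- The filter of the sets of places that contain every place at which finitely many given elements
of `Kbar` are integral. -/
def almostAllPlaces : Filter (Place K Kbar) :=
  (almostAll Kbar).comap fun P => P.2.ring

theorem eventually_place {Q : ValuationSubring Kbar → Prop}
    (h : ∀ᶠ A : ValuationSubring Kbar in almostAll Kbar, Q A) :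
    ∀ᶠ P in almostAllPlaces K Kbar, Q P.2.ring :=
  Filter.tendsto_comap.eventually h

theorem PlaceOver.isUnit_intCast {𝔭 : Ideal (𝓞 K)} (P : PlaceOver Kbar 𝔭) {n p : ℤ}
    (hnp : IsCoprime n p) (hp : (p : 𝓞 K) ∈ 𝔭) : IsUnit (n : P.ring) := by
  have hp' : ¬IsUnit (p : P.ring) := by
    have h : ((p : P.ring) : Kbar) ∈ P.ring.nonunits := by simpa using (P.mem_iff p).mpr hp
    exact ValuationSubring.coe_mem_nonunits_iff.mp h
  obtain ⟨a, b, hab⟩ := hnp.map (Int.castRingHom P.ring)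
  rcases IsLocalRing.isUnit_or_isUnit_of_add_one hab with h | h
  · exact isUnit_of_mul_isUnit_right h
  · exact absurd (isUnit_of_mul_isUnit_right h) hp'

theorem exists_forall_of_eventually_almostAllPlaces [Algebra.IsAlgebraic ℤ Kbar]
    {Q : Place K Kbar → Prop} (h : ∀ᶠ P in almostAllPlaces K Kbar, Q P) :
    ∃ D : ℕ, 0 < D ∧ ∀ p : ℕ, p.Prime → ¬p ∣ D →
      ∀ (𝔭 : Ideal (𝓞 K)) (P : PlaceOver Kbar 𝔭), (p : 𝓞 K) ∈ 𝔭 → Q ⟨𝔭, P⟩ := by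
  obtain ⟨t, ht, htQ⟩ := Filter.mem_comap.mp h
  obtain ⟨T, hT, hTt⟩ := (Filter.hasBasis_iInf_principal_finite _).mem_iff.mp ht
  obtain ⟨n, hn, hint⟩ := Algebra.IsAlgebraic.exists_integral_multiples ℤ hT.toFinset
  refine ⟨n.natAbs, Int.natAbs_pos.mpr hn, fun p hp hpn 𝔭 P hp𝔭 => htQ (hTt ?_)⟩
  have hcop : IsCoprime n (p : ℤ) :=
    ((Nat.prime_iff_prime_int.mp hp).coprime_iff_not_dvd.mpr (mt Int.natCast_dvd.mp hpn)).symm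
  obtain ⟨c, hc⟩ := isUnit_iff_exists_inv'.mp (P.isUnit_intCast hcop (by simpa using hp𝔭))
  refine Set.mem_iInter₂.mpr fun x hx => ?_
  have hnx : x = c * (n • x) := by
    have hc' : (c : Kbar) * n = 1 := by simpa using congrArg Subtype.val hc
    rw [zsmul_eq_mul, ← mul_assoc, hc', one_mul]
  exact hnx ▸ P.ring.mul_mem _ _ c.2 (mem_of_isIntegral P.ring (hint x (hT.mem_toFinset.mpr hx)))

end Places

section DualNumber

open TrivSqZeroExt

theorem formallyUnramified_of_forall_derivation_eq_zero {k A : Type*} [CommRing k] [CommRing A]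
    [Algebra k A] [Algebra.EssFiniteType k A]
    (H : ∀ m : Ideal A, m.IsMaximal → ∀ D : Derivation k A (A ⧸ m), D = 0) :
    Algebra.FormallyUnramified k A := by
  refine ⟨not_nontrivial_iff_subsingleton.mp fun hΩ => ?_⟩
  obtain ⟨N, hN, -⟩ :=
    (eq_top_or_exists_le_coatom (⊥ : Submodule A Ω[A⁄k])).resolve_left bot_ne_top
  have : IsSimpleModule A (Ω[A⁄k] ⧸ N) := isSimpleModule_iff_isCoatom.mpr hN
  obtain ⟨m, hm, ⟨e⟩⟩ := isSimpleModule_iff_quot_maximal.mp this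
  let φ : Ω[A⁄k] →ₗ[A] A ⧸ m := e.toLinearMap ∘ₗ N.mkQ
  have hφ : φ = 0 := LinearMap.ext_on_range (KaehlerDifferential.span_range_derivation k A)
    fun a => congrArg (· a) (H m hm (φ.compDer (KaehlerDifferential.D k A)))
  obtain ⟨y, hy⟩ : ∃ y, φ y = 1 := e.surjective.comp N.mkQ_surjective 1
  rw [hφ] at hy
  exact zero_ne_one hy

/-- A derivation at a point of an affine scheme is a tangent vector, that is, a point with values in
the dual numbers. -/
theorem finite_algHom_of_forall_dualNumber {k A : Type*} [Field k] [IsAlgClosed k] [CommRing A]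
    [Algebra k A] [Algebra.FiniteType k A] (H : ∀ (φ : A →ₐ[k] DualNumber k) a, (φ a).snd = 0) :
    Finite (A →ₐ[k] k) := by
  have : Algebra.FormallyUnramified k A := by
    refine formallyUnramified_of_forall_derivation_eq_zero fun m hm D => Derivation.ext fun a => ?_
    let : Field (A ⧸ m) := Ideal.Quotient.field m
    have : Module.Finite k (A ⧸ m) := finite_of_finite_type_of_isJacobsonRing k (A ⧸ m)
    let e : (A ⧸ m) ≃ₐ[k] k := (AlgEquiv.ofBijective (Algebra.ofId k (A ⧸ m))
      IsAlgClosed.algebraMap_bijective_of_isIntegral).symm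
    let π : A →ₐ[k] k := (e : (A ⧸ m) →ₐ[k] k).comp (Ideal.Quotient.mkₐ k m)
    have hsmul : ∀ a (b : A ⧸ m), e (a • b) = π a * e b := fun a b => by
      rw [Algebra.smul_def, map_mul]
      rfl
    let φ : A →ₐ[k] DualNumber k := AlgHom.ofLinearMap
      { toFun := fun a => inl (π a) + inr (e (D a))
        map_add' := fun a b => by ext <;> simp
        map_smul' := fun c a => by ext <;> simp }
      (by ext <;> simp) (fun a b => by ext <;> simp [hsmul, mul_comm])
    have hφ : (φ a).snd = e (D a) := by simp [φ]
    exact e.injective (by rw [← hφ, H, Derivation.zero_apply, map_zero])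
  have := Algebra.FormallyUnramified.finite_of_free k A
  infer_instance

theorem finite_zeros_of_forall_tangent_eq_zero {k σ : Type*} [Field k] [IsAlgClosed k] [Finite σ]
    {S : Set (MvPolynomial σ k)}
    (H : ∀ x v : σ → k,
      (∀ f ∈ S, MvPolynomial.aeval (fun i => inl (x i) + inr (v i) : σ → DualNumber k) f = 0) →
      v = 0) :
    {x : σ → k | ∀ f ∈ S, MvPolynomial.aeval x f = 0}.Finite := by
  let A := MvPolynomial σ k ⧸ Ideal.span S
  have : Finite (A →ₐ[k] k) := finite_algHom_of_forall_dualNumber fun φ a => by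
    let x : σ → DualNumber k := fun i => φ (Ideal.Quotient.mk _ (MvPolynomial.X i))
    have hφ : ∀ f, φ (Ideal.Quotient.mk _ f) = MvPolynomial.aeval x f :=
      fun f => congrArg (· f) (MvPolynomial.aeval_unique (φ.comp (Ideal.Quotient.mkₐ k _)))
    have hv : (fun i => (x i).snd) = 0 := H (fun i => (x i).fst) _ fun f hf => by
      simp only [inl_fst_add_inr_snd_eq, ← hφ]
      rw [Ideal.Quotient.eq_zero_iff_mem.mpr (Ideal.subset_span hf), map_zero]
    have hx : x = fun i => inlAlgHom k k k (x i).fst := funext fun i =>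
      TrivSqZeroExt.ext rfl (congrFun hv i)
    obtain ⟨f, rfl⟩ := Ideal.Quotient.mk_surjective a
    rw [hφ, hx, ← MvPolynomial.comp_aeval_apply]
    rfl
  let toAlgHom (x : {x : σ → k | ∀ f ∈ S, MvPolynomial.aeval x f = 0}) : A →ₐ[k] k :=
    Ideal.Quotient.liftₐ _ (MvPolynomial.aeval x.1) fun a ha =>
      (Ideal.span_le.mpr x.2 : Ideal.span S ≤ RingHom.ker (MvPolynomial.aeval x.1)) ha
  refine Finite.of_injective toAlgHom fun x y hxy => Subtype.ext (funext fun i => ?_)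
  have hX : ∀ z, toAlgHom z (Ideal.Quotient.mk _ (MvPolynomial.X i)) = z.1 i := fun z =>
    MvPolynomial.aeval_X z.1 i
  rw [← hX, hxy, hX]

theorem aeval_inl_add_inr {k R σ : Type*} [CommRing k] [CommRing R] [Algebra k R] [Fintype σ]
    (x v : σ → R) (f : MvPolynomial σ k) :
    MvPolynomial.aeval (fun i => inl (x i) + inr (v i) : σ → DualNumber R) f =
      inl (MvPolynomial.aeval x f) +
        inr (∑ i, MvPolynomial.aeval x (MvPolynomial.pderiv i f) * v i) := by
  classical
  induction f using MvPolynomial.induction_on with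
  | C a =>
    have h : algebraMap k (DualNumber R) a = inl (algebraMap k R a) := rfl
    simp [h]
  | add p q hp hq =>
    rw [map_add, hp, hq]
    simp [TrivSqZeroExt.ext_iff, Finset.sum_add_distrib, add_mul]
  | mul_X p j hp =>
    have hsum : ∑ i, MvPolynomial.aeval x (MvPolynomial.pderiv i (p * MvPolynomial.X j)) * v i =
        MvPolynomial.aeval x p * v j +
          x j * ∑ i, MvPolynomial.aeval x (MvPolynomial.pderiv i p) * v i := by
      simp [MvPolynomial.pderiv_X, Pi.single_apply, apply_ite (MvPolynomial.aeval x), add_mul,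
        Finset.sum_add_distrib, Finset.mul_sum, mul_assoc]
    rw [map_mul, hp, hsum, MvPolynomial.aeval_X]
    ext
    · simp
    · simp only [DualNumber.snd_mul, snd_add, snd_inl, snd_inr, fst_add, fst_inl, fst_inr]
      ring

end DualNumber

section LinesOnHypersurface

open Polynomial (X C)

theorem coeff_prod_sum_of_natDegree_le {R ι : Type*} [CommSemiring R] (s : Finset ι)
    (p : ι → Polynomial R) (n : ι → ℕ) (h : ∀ i ∈ s, (p i).natDegree ≤ n i) :
    (∏ i ∈ s, p i).coeff (∑ i ∈ s, n i) = ∏ i ∈ s, (p i).coeff (n i) := by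
  classical
  induction s using Finset.induction_on with
  | empty => simp
  | insert i s hi ih =>
    have hs : ∀ j ∈ s, (p j).natDegree ≤ n j := fun j hj => h j (Finset.mem_insert_of_mem hj)
    rw [Finset.prod_insert hi, Finset.sum_insert hi, Finset.prod_insert hi, ← ih hs]
    exact Polynomial.coeff_mul_add_eq_of_natDegree_le (h i (Finset.mem_insert_self i s))
      ((Polynomial.natDegree_prod_le s p).trans (Finset.sum_le_sum hs))

theorem coeff_aeval_linear {k Ω ι : Type*} [CommSemiring k] [CommSemiring Ω] [Algebra k Ω]
    {G : MvPolynomial ι k} {n : ℕ} (hG : G.IsHomogeneous n) (x y : ι → Ω) :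
    (MvPolynomial.aeval (fun m => C (x m) * X + C (y m)) G).coeff n = MvPolynomial.aeval x G := by
  have hmonomial : ∀ (d : ι →₀ ℕ) (c : k), (MvPolynomial.aeval (fun m => C (x m) * X + C (y m))
      (MvPolynomial.monomial d c)).coeff d.degree =
        MvPolynomial.aeval x (MvPolynomial.monomial d c) := fun d c => by
    have hle : ∀ m e, ((C (x m) * X + C (y m)) ^ e).natDegree ≤ e := fun m e => by
      simpa using Polynomial.natDegree_pow_le_of_le e Polynomial.natDegree_linear_le
    have hcoeff : ∀ m e, ((C (x m) * X + C (y m)) ^ e).coeff e = x m ^ e := fun m e => by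
      simpa using Polynomial.coeff_pow_of_natDegree_le (m := e)
        (Polynomial.natDegree_linear_le (a := x m) (b := y m))
    rw [MvPolynomial.aeval_monomial, MvPolynomial.aeval_monomial, Polynomial.algebraMap_apply,
      Polynomial.coeff_C_mul, Finsupp.prod, Finsupp.degree_apply,
      coeff_prod_sum_of_natDegree_le _ _ _ fun m _ => hle m _]
    exact congrArg _ (Finset.prod_congr rfl fun m _ => hcoeff m _)
  conv_lhs => rw [MvPolynomial.as_sum G]
  conv_rhs => rw [MvPolynomial.as_sum G]
  rw [map_sum, map_sum, Polynomial.finsetSum_coeff]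
  refine Finset.sum_congr rfl fun d hd => ?_
  rw [← hmonomial, hG.degree_eq_sum_deg_support hd]
  rfl

theorem eval_aeval_linear {Ω ι : Type*} [CommSemiring Ω] (G : MvPolynomial ι Ω) (x y : ι → Ω)
    (t : Ω) :
    (MvPolynomial.aeval (fun m => C (x m) * X + C (y m)) G).eval t =
      MvPolynomial.aeval (t • x + y) G := by
  rw [← Polynomial.coe_aeval_eq_eval, MvPolynomial.comp_aeval_apply]
  congr 2
  ext m
  simp [mul_comm (x m)]

theorem eq_zero_of_mul_add_mul_eq_zero {R : Type*} [CommRing R] [IsDomain R]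
    {a b p q : Polynomial R} {n : ℕ} (hpq : IsCoprime p q) (h : a * p + b * q = 0)
    (ha : a.natDegree < n) (hb : b.natDegree < n) (hn : p.coeff n ≠ 0 ∨ q.coeff n ≠ 0) :
    a = 0 ∧ b = 0 := by
  wlog hp : p.coeff n ≠ 0 generalizing a b p q
  · exact (this hpq.symm (by rwa [add_comm]) hb ha hn.symm (hn.resolve_left hp)).symm
  have hb0 : b = 0 := by
    have hdvd : p ∣ b := hpq.dvd_of_dvd_mul_right ⟨-a, by linear_combination h⟩
    refine Polynomial.eq_zero_of_dvd_of_natDegree_lt hdvd ?_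
    exact hb.trans_le (Polynomial.le_natDegree_of_ne_zero hp)
  rw [hb0, zero_mul, add_zero] at h
  exact ⟨(mul_eq_zero.mp h).resolve_right fun hp0 => hp (by simp [hp0]), hb0⟩

section Gradient

variable {Ω ι : Type*} [Field Ω] {F : MvPolynomial ι Ω} {W : Submodule Ω (ι → Ω)}

theorem sum_aeval_pderiv_mul_eq_zero [Infinite Ω] [Fintype ι]
    (hW : ∀ x ∈ W, MvPolynomial.aeval x F = 0) {x y : ι → Ω} (hx : x ∈ W) (hy : y ∈ W) :
    ∑ m, MvPolynomial.aeval x (MvPolynomial.pderiv m F) * y m = 0 := by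
  have hline : MvPolynomial.aeval (fun m => C (y m) * X + C (x m)) F = 0 :=
    Polynomial.funext fun t => by
      rw [eval_aeval_linear, hW _ (W.add_mem (W.smul_mem t hy) hx), Polynomial.eval_zero]
  have hdual := congrArg (Polynomial.aeval (DualNumber.eps : DualNumber Ω)) hline
  have hpoint :
      (fun m => Polynomial.aeval (DualNumber.eps : DualNumber Ω) (C (y m) * X + C (x m))) =
        fun m => TrivSqZeroExt.inl (x m) + TrivSqZeroExt.inr (y m) := funext fun m => by
    ext <;> simp [TrivSqZeroExt.algebraMap_eq_inl]
  rw [MvPolynomial.comp_aeval_apply, hpoint, aeval_inl_add_inr, map_zero] at hdual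
  simpa using congrArg TrivSqZeroExt.snd hdual

theorem exists_notMem_aeval_pderiv_ne_zero [Infinite Ω] [Finite ι] [DecidableEq ι] {s : Finset ι}
    {b : ι → ι → Ω} (hb : IsFrame W s b) (hW : ∀ x ∈ W, MvPolynomial.aeval x F = 0) {x : ι → Ω}
    (hx : x ∈ W) (hsmooth : ∃ i, MvPolynomial.aeval x (MvPolynomial.pderiv i F) ≠ 0) :
    ∃ m ∉ s, MvPolynomial.aeval x (MvPolynomial.pderiv m F) ≠ 0 := by
  have := Fintype.ofFinite ι
  by_contra! hs
  obtain ⟨i, hi⟩ := hsmooth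
  refine hi ((sum_aeval_pderiv_mul_eq_zero hW hx (hb.mem i)).symm.trans ?_).symm
  rw [Finset.sum_eq_single i]
  · rw [hb.apply i i (by_contra fun his => hi (hs i his)), if_pos rfl, mul_one]
  · intro m _ hmi
    by_cases hm : m ∈ s
    · rw [hb.apply i m hm, if_neg hmi, mul_zero]
    · rw [hs m hm, zero_mul]
  · exact fun h => absurd (Finset.mem_univ i) h

end Gradient

section Tangent

variable {Ω ι : Type*} [Field Ω] [IsAlgClosed Ω]

theorem eq_zero_of_forall_aeval_mul_add_eq_zero {G H : MvPolynomial ι Ω} {n : ℕ}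
    (hG : G.IsHomogeneous n) (hH : H.IsHomogeneous n) (hn : 2 ≤ n) {x y : ι → Ω}
    (hne : ∀ t u : Ω, t ≠ 0 ∨ u ≠ 0 →
      MvPolynomial.aeval (t • x + u • y) G ≠ 0 ∨ MvPolynomial.aeval (t • x + u • y) H ≠ 0)
    {a b a' b' : Ω} (h : ∀ t : Ω, (t * a + b) * MvPolynomial.aeval (t • x + y) G +
      (t * a' + b') * MvPolynomial.aeval (t • x + y) H = 0) :
    (a = 0 ∧ b = 0) ∧ a' = 0 ∧ b' = 0 := by
  let onLine (Q : MvPolynomial ι Ω) : Polynomial Ω :=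
    MvPolynomial.aeval (fun m => C (x m) * X + C (y m)) Q
  have heval : ∀ Q t, (onLine Q).eval t = MvPolynomial.aeval (t • x + y) Q :=
    fun Q => eval_aeval_linear Q x y
  have hcoprime : IsCoprime (onLine G) (onLine H) := by
    rw [Polynomial.isCoprime_iff_aeval_ne_zero_of_isAlgClosed Ω Ω]
    intro t
    simpa [Polynomial.coe_aeval_eq_eval, heval] using hne t 1 (.inr one_ne_zero)
  have hrelation : (C a * X + C b) * onLine G + (C a' * X + C b') * onLine H = 0 :=
    Polynomial.funext fun t => by
      simpa [heval, mul_comm t] using h t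
  obtain ⟨hab, hab'⟩ := eq_zero_of_mul_add_mul_eq_zero hcoprime hrelation
    (Polynomial.natDegree_linear_le.trans_lt hn) (Polynomial.natDegree_linear_le.trans_lt hn) (by
      simpa only [onLine, coeff_aeval_linear hG, coeff_aeval_linear hH, one_smul, zero_smul,
        add_zero] using hne 1 0 (.inl one_ne_zero))
  have hcoeff : ∀ {c e : Ω}, C c * X + C e = 0 → c = 0 ∧ e = 0 := fun h =>
    ⟨by simpa using congrArg (Polynomial.coeff · 1) h,
      by simpa using congrArg (Polynomial.coeff · 0) h⟩
  exact ⟨hcoeff hab, hcoeff hab'⟩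

variable [Fintype ι] [DecidableEq ι] {F : MvPolynomial ι Ω} {d : ℕ} {s : Finset ι}
  {W : Submodule Ω (ι → Ω)} {b v : ι → ι → Ω}

/-- Along a line with coordinate `t`, the two partial derivatives `p, q` of `F` transverse to the
pivots have degree `d - 1 ≥ 2` and no common zero, whereas a tangent vector gives a relation
`α p + β q = 0` with `α, β` of degree at most `1`. -/
theorem IsFrame.tangent_eq_zero (hb : IsFrame W s b) (hs : s.card = 2) (hι : Fintype.card ι = 4)
    (hF : F.IsHomogeneous d) (hd : 3 ≤ d) (hW : ∀ x ∈ W, MvPolynomial.aeval x F = 0)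
    (hsmooth : ∀ x ∈ W, x ≠ 0 → ∃ i, MvPolynomial.aeval x (MvPolynomial.pderiv i F) ≠ 0)
    (hvs : ∀ j, ∀ i ∈ s, v j i = 0) (hv : ∀ j ∉ s, v j = 0)
    (htangent : ∀ c : ι → Ω, ∑ m, (∑ j ∈ s, c j • v j) m *
      MvPolynomial.aeval (∑ j ∈ s, c j • b j) (MvPolynomial.pderiv m F) = 0) :
    v = 0 := by
  obtain ⟨i, j, hij, rfl⟩ := Finset.card_eq_two.mp hs
  obtain ⟨k, l, hkl, hcompl⟩ := Finset.card_eq_two.mp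
    (show ({i, j} : Finset ι)ᶜ.card = 2 by rw [Finset.card_compl, hι, hs])
  have hmem : ∀ m, m ∉ ({i, j} : Finset ι) ↔ m = k ∨ m = l := fun m => by
    rw [← Finset.mem_compl, hcompl, Finset.mem_insert, Finset.mem_singleton]
  have hgradient : ∀ t u : Ω, t ≠ 0 ∨ u ≠ 0 →
      MvPolynomial.aeval (t • b i + u • b j) (MvPolynomial.pderiv k F) ≠ 0 ∨
      MvPolynomial.aeval (t • b i + u • b j) (MvPolynomial.pderiv l F) ≠ 0 := fun t u htu => by
    have hx : t • b i + u • b j ∈ W :=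
      W.add_mem (W.smul_mem t (hb.mem i)) (W.smul_mem u (hb.mem j))
    have hx0 : t • b i + u • b j ≠ 0 := fun h => htu.elim
      (fun ht => ht (by simpa [hb.apply _ i, hij] using congrFun h i))
      fun hu => hu (by simpa [hb.apply _ j, hij.symm] using congrFun h j)
    obtain ⟨m, hm, hne⟩ := exists_notMem_aeval_pderiv_ne_zero hb hW hx (hsmooth _ hx hx0)
    rcases (hmem m).mp hm with rfl | rfl
    exacts [.inl hne, .inr hne]
  have hrelation : ∀ t : Ω,
      (t * v i k + v j k) * MvPolynomial.aeval (t • b i + b j) (MvPolynomial.pderiv k F) +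
        (t * v i l + v j l) * MvPolynomial.aeval (t • b i + b j) (MvPolynomial.pderiv l F) = 0 :=
    fun t => by
      have h := htangent fun n => if n = i then t else 1
      simp only [Finset.sum_pair hij, hij.symm, if_true, if_false, one_smul] at h
      rwa [← Finset.sum_subset (Finset.subset_univ ({k, l} : Finset ι)) fun m _ hm => ?_,
        Finset.sum_pair hkl] at h
      have hm' : m ∈ ({i, j} : Finset ι) := not_not.mp (mt (hmem m).mp (by simpa using hm))
      simp [hvs _ m hm']
  obtain ⟨⟨hik, hjk⟩, hil, hjl⟩ := eq_zero_of_forall_aeval_mul_add_eq_zero hF.pderiv hF.pderiv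
    (Nat.le_sub_one_of_lt hd) hgradient hrelation
  funext n m
  by_cases hn : n ∉ ({i, j} : Finset ι)
  · simp [hv n hn]
  by_cases hm : m ∈ ({i, j} : Finset ι)
  · exact hvs n m hm
  obtain rfl | rfl : n = i ∨ n = j := by
    rwa [not_not, Finset.mem_insert, Finset.mem_singleton] at hn
  all_goals rcases (hmem m).mp hm with rfl | rfl <;> assumption

end Tangent

end LinesOnHypersurface

section FrameEquations

variable {Ω ι : Type*} [Field Ω] [DecidableEq ι] {F : MvPolynomial ι Ω} {s : Finset ι}

/-- Equations, in the entries of a matrix `b`, which say that `b` is the frame with pivot set `s` of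
a linear subspace on which `F` vanishes. -/
def frameEquations (F : MvPolynomial ι Ω) (s : Finset ι) : Set (MvPolynomial (ι × ι) Ω) :=
  {f | (∃ j, ∃ i ∈ s, f = MvPolynomial.X (j, i) - if i = j then 1 else 0) ∨
    (∃ j ∉ s, ∃ i, f = MvPolynomial.X (j, i)) ∨
    ∃ c : ι → Ω, f = MvPolynomial.aeval
      (fun m => ∑ j ∈ s, MvPolynomial.C (c j) * MvPolynomial.X (j, m)) F}

theorem forall_frameEquations_iff {R : Type*} [CommRing R] [Algebra Ω R] {x : ι × ι → R} :
    (∀ f ∈ frameEquations F s, MvPolynomial.aeval x f = 0) ↔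
      (∀ j, ∀ i ∈ s, x (j, i) = if i = j then 1 else 0) ∧ (∀ j ∉ s, ∀ i, x (j, i) = 0) ∧
        ∀ c : ι → Ω,
          MvPolynomial.aeval (fun m => ∑ j ∈ s, algebraMap Ω R (c j) * x (j, m)) F = 0 := by
  have hunit : ∀ j i, MvPolynomial.aeval x
      (MvPolynomial.X (j, i) - if i = j then 1 else 0 : MvPolynomial (ι × ι) Ω) = 0 ↔
      x (j, i) = if i = j then 1 else 0 := fun j i => by
    rw [map_sub, MvPolynomial.aeval_X, apply_ite (MvPolynomial.aeval x), map_one, map_zero,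
      sub_eq_zero]
  have hform : ∀ c : ι → Ω, MvPolynomial.aeval x (MvPolynomial.aeval
      (fun m => ∑ j ∈ s, MvPolynomial.C (c j) * MvPolynomial.X (j, m)) F) =
      MvPolynomial.aeval (fun m => ∑ j ∈ s, algebraMap Ω R (c j) * x (j, m)) F := fun c => by
    rw [MvPolynomial.comp_aeval_apply (φ := (MvPolynomial.aeval x))]
    simp
  constructor
  · intro h
    exact ⟨fun j i hi => (hunit j i).mp (h _ (.inl ⟨j, i, hi, rfl⟩)),
      fun j hj i => by simpa using h _ (.inr (.inl ⟨j, hj, i, rfl⟩)),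
      fun c => (hform c).symm.trans (h _ (.inr (.inr ⟨c, rfl⟩)))⟩
  · rintro ⟨h₁, h₂, h₃⟩ f (⟨j, i, hi, rfl⟩ | ⟨j, hj, i, rfl⟩ | ⟨c, rfl⟩)
    exacts [(hunit j i).mpr (h₁ j i hi), by simpa using h₂ j hj i, (hform c).trans (h₃ c)]

theorem exists_isFrame_of_forall_frameEquations {x : ι × ι → Ω}
    (hx : ∀ f ∈ frameEquations F s, MvPolynomial.aeval x f = 0) :
    ∃ W, IsFrame W s (fun j i => x (j, i)) ∧ ∀ y ∈ W, MvPolynomial.aeval y F = 0 := by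
  obtain ⟨h₁, h₂, h₃⟩ := forall_frameEquations_iff.mp hx
  have hframe := isFrame_span_range (b := fun j i => x (j, i)) h₁ fun j hj => funext (h₂ j hj)
  refine ⟨_, hframe, fun y hy => ?_⟩
  rw [← h₃ y]
  congr 2
  ext m
  simpa [Finset.sum_apply] using (congrFun (hframe.mem_iff.mp hy) m).symm

theorem IsFrame.forall_frameEquations {W : Submodule Ω (ι → Ω)} {b : ι → ι → Ω}
    (hb : IsFrame W s b) (hW : ∀ x ∈ W, MvPolynomial.aeval x F = 0) :
    ∀ f ∈ frameEquations F s, MvPolynomial.aeval (fun ji : ι × ι => b ji.1 ji.2) f = 0 :=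
  forall_frameEquations_iff.mpr ⟨hb.apply, fun j hj i => congrFun (hb.eq_zero_of_notMem hj) i,
    fun c => by simpa [Finset.sum_fn] using hW _ (hb.sum_smul_mem c)⟩

theorem tangent_frameEquations [Fintype ι] {x v : ι × ι → Ω}
    (hxv : ∀ f ∈ frameEquations F s, MvPolynomial.aeval (fun ji =>
      TrivSqZeroExt.inl (x ji) + TrivSqZeroExt.inr (v ji) : ι × ι → DualNumber Ω) f = 0) :
    (∀ f ∈ frameEquations F s, MvPolynomial.aeval x f = 0) ∧
      (∀ j, ∀ i ∈ s, v (j, i) = 0) ∧ (∀ j ∉ s, ∀ i, v (j, i) = 0) ∧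
        ∀ c : ι → Ω, ∑ m, (∑ j ∈ s, c j * v (j, m)) *
          MvPolynomial.aeval (fun m => ∑ j ∈ s, c j * x (j, m)) (MvPolynomial.pderiv m F) = 0 := by
  have hx : ∀ f ∈ frameEquations F s, MvPolynomial.aeval x f = 0 := fun f hf => by
    simpa using congrArg TrivSqZeroExt.fst ((aeval_inl_add_inr x v f).symm.trans (hxv f hf))
  obtain ⟨h₁, h₂, h₃⟩ := forall_frameEquations_iff.mp hxv
  refine ⟨hx, fun j i hi => ?_, fun j hj i => ?_, fun c => ?_⟩
  · have h := congrArg TrivSqZeroExt.snd (h₁ j i hi)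
    split_ifs at h <;> simpa using h
  · simpa using congrArg TrivSqZeroExt.snd (h₂ j hj i)
  · have hpoint : (fun m => ∑ j ∈ s, algebraMap Ω (DualNumber Ω) (c j) *
        (TrivSqZeroExt.inl (x (j, m)) + TrivSqZeroExt.inr (v (j, m)))) =
        fun m => TrivSqZeroExt.inl (∑ j ∈ s, c j * x (j, m)) +
          TrivSqZeroExt.inr (∑ j ∈ s, c j * v (j, m)) := funext fun m => by
      simp only [TrivSqZeroExt.algebraMap_eq_inl, mul_add, ← TrivSqZeroExt.inl_mul,
        TrivSqZeroExt.inl_mul_inr, Finset.sum_add_distrib, TrivSqZeroExt.inl_sum,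
        TrivSqZeroExt.inr_sum, smul_eq_mul]
    have h := h₃ c
    rw [hpoint, aeval_inl_add_inr] at h
    simpa [mul_comm] using congrArg TrivSqZeroExt.snd h

end FrameEquations

section FiniteLines

variable {Ω ι : Type*} [Field Ω] [IsAlgClosed Ω] [Fintype ι] {F : MvPolynomial ι Ω} {d : ℕ}

theorem finite_zeros_frameEquations [DecidableEq ι] {s : Finset ι} (hs : s.card = 2)
    (hι : Fintype.card ι = 4) (hF : F.IsHomogeneous d) (hd : 3 ≤ d)
    (hsmooth : ∀ x : ι → Ω, x ≠ 0 → MvPolynomial.aeval x F = 0 →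
      ∃ i, MvPolynomial.aeval x (MvPolynomial.pderiv i F) ≠ 0) :
    {x : ι × ι → Ω | ∀ f ∈ frameEquations F s, MvPolynomial.aeval x f = 0}.Finite := by
  refine finite_zeros_of_forall_tangent_eq_zero fun x v hxv => ?_
  obtain ⟨hx, hvs, hv, htangent⟩ := tangent_frameEquations hxv
  obtain ⟨W, hframe, hW⟩ := exists_isFrame_of_forall_frameEquations hx
  have hv0 := hframe.tangent_eq_zero (v := fun j i => v (j, i)) hs hι hF hd hW
    (fun y hy hy0 => hsmooth y hy0 (hW y hy)) hvs (fun j hj => funext (hv j hj))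
    fun c => by simpa [Finset.sum_fn] using htangent c
  exact funext fun ji => congrFun₂ hv0 ji.1 ji.2

theorem finite_lines_of_isHomogeneous (hι : Fintype.card ι = 4) (hF : F.IsHomogeneous d)
    (hd : 3 ≤ d) (hsmooth : ∀ x : ι → Ω, x ≠ 0 → MvPolynomial.aeval x F = 0 →
      ∃ i, MvPolynomial.aeval x (MvPolynomial.pderiv i F) ≠ 0) :
    {W : Submodule Ω (ι → Ω) | Module.finrank Ω W = 2 ∧
      ∀ x ∈ W, MvPolynomial.aeval x F = 0}.Finite := by
  classical
  have hfin : (⋃ s ∈ {s : Finset ι | s.card = 2}, (fun x => (s, x)) ''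
      {x : ι × ι → Ω | ∀ f ∈ frameEquations F s, MvPolynomial.aeval x f = 0}).Finite :=
    (Set.toFinite _).biUnion fun s hs =>
      (finite_zeros_frameEquations hs hι hF hd hsmooth).image _
  refine Set.Finite.of_finite_image (f := fun W => (pivotSet W, fun ji => frame W ji.1 ji.2))
    (hfin.subset ?_) fun W _ W' _ h => ?_
  · rintro _ ⟨W, ⟨hdim, hW⟩, rfl⟩
    have hframe := isFrame_frame W
    exact Set.mem_biUnion (hframe.finrank_eq.symm.trans hdim)
      ⟨_, hframe.forall_frameEquations hW, rfl⟩
  · have hframe : frame W = frame W' :=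
      funext₂ fun j i => congrFun (congrArg Prod.snd h) (j, i)
    refine (isFrame_frame W).left_unique ?_
    rw [hframe, show pivotSet W = pivotSet W' from congrArg Prod.fst h]
    exact isFrame_frame W'

theorem finite_linesOn {k : Type*} [CommRing k] {Ω : Type*} [Field Ω] [IsAlgClosed Ω] [Algebra k Ω]
    {F : MvPolynomial (Fin 4) k} (hF : IsSmoothQuartic F Ω) : (linesOn F Ω).Finite := by
  have h := finite_lines_of_isHomogeneous (F := MvPolynomial.map (algebraMap k Ω) F)
    (Fintype.card_fin 4) (hF.1.map _) (by norm_num) fun x hx hFx => by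
      simpa only [MvPolynomial.pderiv_map, MvPolynomial.aeval_map_algebraMap] using
        hF.2 x hx (by simpa only [MvPolynomial.aeval_map_algebraMap] using hFx)
  simpa only [MvPolynomial.aeval_map_algebraMap, linesOn] using h

end FiniteLines

section Separation

theorem exists_apply_injective {k V V' α : Type*} [DivisionRing k] [Infinite k] [AddCommGroup V]
    [Module k V] [AddCommGroup V'] [Module k V'] [Finite α] {φ : α → V →ₗ[k] V'}
    (hφ : Function.Injective φ) : ∃ v, Function.Injective fun i => φ i v := by
  classical
  have := Fintype.ofFinite α
  let pairs := Finset.univ.filter fun p : α × α => p.1 ≠ p.2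
  have htop : ⊤ ∉ pairs.image fun p => LinearMap.eqLocus (φ p.1) (φ p.2) := fun h => by
    obtain ⟨p, hp, hφp⟩ := Finset.mem_image.mp h
    exact (Finset.mem_filter.mp hp).2 (hφ (LinearMap.eqLocus_eq_top.mp hφp))
  obtain ⟨v, hv⟩ := (Set.ne_univ_iff_exists_notMem _).mp
    (Subspace.biUnion_ne_univ_of_top_notMem htop)
  refine ⟨v, fun i j hij => by_contra fun hne => hv ?_⟩
  have hmem : LinearMap.eqLocus (φ i) (φ j) ∈
      pairs.image fun p => LinearMap.eqLocus (φ p.1) (φ p.2) :=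
    Finset.mem_image.mpr ⟨(i, j), Finset.mem_filter.mpr ⟨Finset.mem_univ _, hne⟩, rfl⟩
  exact Set.mem_biUnion hmem hij

variable {Ω ι : Type*} [Field Ω] [Finite ι]

theorem exists_equivariant_injOn (K : Type*) [Field K] [Infinite K] [Algebra K Ω]
    {L : Set (Submodule Ω (ι → Ω))} (hL : L.Finite) :
    ∃ α : Submodule Ω (ι → Ω) → Ω,
      (∀ (σ : Ω ≃ₐ[K] Ω) W, α (galConj σ W) = σ (α W)) ∧ Set.InjOn α L := by
  classical
  have := Fintype.ofFinite ι
  have := hL.to_subtype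
  let φ (W : Submodule Ω (ι → Ω)) : (ι × ι → K) →ₗ[K] Ω :=
    Fintype.linearCombination K fun ji => frame W ji.1 ji.2
  have hφ : Function.Injective φ := fun W W' h => frame_injective <| funext₂ fun j i => by
    simpa [φ] using DFunLike.congr_fun h (Pi.single (j, i) 1)
  obtain ⟨a, ha⟩ := exists_apply_injective (hφ.comp (Subtype.val_injective (p := (· ∈ L))))
  refine ⟨fun W => φ W a, fun σ W => ?_, fun W hW W' hW' h => ?_⟩
  · simp [φ, Fintype.linearCombination_apply, frame_galConj]
  · exact congrArg Subtype.val (@ha ⟨W, hW⟩ ⟨W', hW'⟩ h)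

end Separation

section Descent

variable {K Ω : Type*} [Field K] [Field Ω] [Algebra K Ω]

theorem exists_map_eq_of_forall_map_eq [IsGalois K Ω] {f : Polynomial Ω}
    (hf : ∀ σ : Ω ≃ₐ[K] Ω, f.map (σ : Ω →+* Ω) = f) :
    ∃ g : Polynomial K, g.map (algebraMap K Ω) = f := by
  refine (Polynomial.mem_lifts f).mp ((Polynomial.lifts_iff_coeff_lifts f).mpr fun n => ?_)
  refine (InfiniteGalois.mem_range_algebraMap_iff_fixed _).mpr fun σ => ?_
  simpa using congrArg (Polynomial.coeff · n) (hf σ)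

theorem exists_monic_separable_rootSet_eq [IsGalois K Ω] {Z : Set Ω} (hZ : Z.Finite)
    (hstable : ∀ (σ : Ω ≃ₐ[K] Ω), ∀ z ∈ Z, σ z ∈ Z) :
    ∃ g : Polynomial K, g.Monic ∧ g.Separable ∧ g.rootSet Ω = Z := by
  classical
  lift Z to Finset Ω using hZ
  simp only [Finset.mem_coe] at hstable
  have himage : ∀ σ : Ω ≃ₐ[K] Ω, Z.image σ = Z := fun σ =>
    Finset.eq_of_subset_of_card_le (Finset.image_subset_iff.mpr (hstable σ))
      (Finset.card_image_of_injective Z σ.injective).ge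
  obtain ⟨g, hg⟩ := exists_map_eq_of_forall_map_eq (K := K)
    (f := ∏ z ∈ Z, (Polynomial.X - Polynomial.C z)) fun σ => by
      rw [Polynomial.map_prod]
      conv_rhs => rw [← himage σ, Finset.prod_image σ.injective.injOn]
      simp
  refine ⟨g, ?_, ?_, ?_⟩
  · refine Polynomial.monic_of_injective (algebraMap K Ω).injective (hg ▸ ?_)
    exact Polynomial.monic_prod_of_monic _ _ fun z _ => Polynomial.monic_X_sub_C z
  · rw [← Polynomial.separable_map (algebraMap K Ω), hg, Polynomial.separable_prod_X_sub_C_iff']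
    exact fun x _ y _ h => h
  · rw [Polynomial.rootSet, Polynomial.aroots, hg, Polynomial.roots_prod_X_sub_C,
      Finset.val_toFinset]

theorem bijOn_apply_root {g : Polynomial K} (hg : g ≠ 0) :
    Set.BijOn (fun p : AdjoinRoot g →ₐ[K] Ω => p (AdjoinRoot.root g)) Set.univ (g.rootSet Ω) := by
  refine ⟨fun p _ => ?_, fun p _ q _ h => AdjoinRoot.algHom_ext h, fun z hz => ?_⟩
  · rw [Polynomial.mem_rootSet_of_ne hg, Polynomial.aeval_algHom_apply, AdjoinRoot.aeval_eq,
      AdjoinRoot.mk_self, map_zero]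
  · have hz : Polynomial.aeval z g = 0 := Polynomial.aeval_eq_zero_of_mem_rootSet hz
    exact ⟨AdjoinRoot.liftAlgHom g (Algebra.ofId K Ω) z hz, trivial,
      AdjoinRoot.liftAlgHom_root g _ _ hz⟩

end Descent

section Existence

theorem isEquivariant_iff_galConj {k Ω B : Type*} [CommRing k] [Field Ω] [Algebra k Ω]
    [CommRing B] [Algebra k B] {η : (B →ₐ[k] Ω) → Submodule Ω (Fin 4 → Ω)} :
    IsEquivariant η ↔
      ∀ (σ : Ω ≃ₐ[k] Ω) (p : B →ₐ[k] Ω), η ((σ : Ω →ₐ[k] Ω).comp p) = galConj σ (η p) := by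
  refine forall₂_congr fun σ p => ⟨fun h => Submodule.ext fun x => ?_, fun h x => ?_⟩
  · simpa using h fun i => σ.symm (x i)
  · simp [h]

theorem galConj_mem_linesOn {k Ω : Type*} [CommRing k] [Field Ω] [Algebra k Ω]
    {F : MvPolynomial (Fin 4) k} {W : Submodule Ω (Fin 4 → Ω)} (hW : W ∈ linesOn F Ω)
    (σ : Ω ≃ₐ[k] Ω) : galConj σ W ∈ linesOn F Ω :=
  ⟨(finrank_galConj σ W).trans hW.1, fun x hx => by
    simpa [hW.2 _ hx] using
      (MvPolynomial.comp_aeval_apply (fun i => σ.symm (x i)) (σ : Ω →ₐ[k] Ω) F).symm⟩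

theorem exists_schemeOfLines {K : Type u} [Field K] [CharZero K] {Kbar : Type v} [Field Kbar]
    [Algebra K Kbar] [IsAlgClosure K Kbar] {F : MvPolynomial (Fin 4) K}
    (hF : IsSmoothQuartic F Kbar) : Nonempty (SchemeOfLines F Kbar) := by
  have := IsAlgClosure.isAlgClosed K (K := Kbar)
  have := IsAlgClosure.isGalois K Kbar
  have hfin : (linesOn F Kbar).Finite := finite_linesOn hF
  obtain ⟨α, hασ, hα⟩ := exists_equivariant_injOn K hfin
  obtain ⟨g, hmonic, hsep, hroots⟩ := exists_monic_separable_rootSet_eq (K := K)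
    (hfin.image α) fun σ _ ⟨W, hW, hz⟩ =>
      ⟨galConj σ W, galConj_mem_linesOn hW σ, hz ▸ hασ σ W⟩
  have hpoints := bijOn_apply_root (Ω := Kbar) hmonic.ne_zero
  rw [hroots] at hpoints
  have hline : Set.BijOn (Function.invFunOn α (linesOn F Kbar)) (α '' linesOn F Kbar)
      (linesOn F Kbar) := hα.bijOn_image.symm hα.bijOn_image.invOn_invFunOn.symm
  refine ⟨{ B := AdjoinRoot g
            finite := hmonic.finite_adjoinRoot
            isReduced := (Ideal.isRadical_iff_quotient_reduced _).mp
              (isRadical_iff_span_singleton.mp hsep.squarefree.isRadical)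
            η := fun p => Function.invFunOn α (linesOn F Kbar) (p (AdjoinRoot.root g))
            bijOn := hline.comp hpoints
            equivariant := isEquivariant_iff_galConj.mpr fun σ p => ?_ }⟩
  obtain ⟨W, hW, hWp : α W = p (AdjoinRoot.root g)⟩ := hpoints.mapsTo (Set.mem_univ p)
  have hσp : (σ : Kbar →ₐ[K] Kbar).comp p (AdjoinRoot.root g) = α (galConj σ W) :=
    (congrArg σ hWp.symm).trans (hασ σ W).symm
  simp only [hσp, ← hWp]
  rw [hα.leftInvOn_invFunOn hW, hα.leftInvOn_invFunOn (galConj_mem_linesOn hW σ)]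

end Existence

section FiniteAlgebra

variable {K B Ω : Type*} [Field K] [CommRing B] [Algebra K B] [Field Ω] [Algebra K Ω]

theorem eq_zero_of_forall_algHom [Algebra.FiniteType K B] [IsReduced B] [IsAlgClosed Ω] {b : B}
    (hb : ∀ p : B →ₐ[K] Ω, p b = 0) : b = 0 := by
  have : IsJacobsonRing B := isJacobsonRing_of_finiteType (A := K)
  have hjac : (⊥ : Ideal B).jacobson = ⊥ :=
    IsJacobsonRing.out ‹_› Ideal.isRadical_bot
  suffices b ∈ (⊥ : Ideal B).jacobson by rwa [hjac, Ideal.mem_bot] at this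
  refine Ideal.mem_sInf.mpr fun {m} ⟨_, hm⟩ => ?_
  let : Field (B ⧸ m) := Ideal.Quotient.field m
  have : Module.Finite K (B ⧸ m) := finite_of_finite_type_of_isJacobsonRing K (B ⧸ m)
  let φ : B ⧸ m →ₐ[K] Ω := IsAlgClosed.lift
  exact Ideal.Quotient.eq_zero_iff_mem.mp
    ((map_eq_zero φ).mp (hb (φ.comp (Ideal.Quotient.mkₐ K m))))

variable [Module.Finite K B]

theorem exists_algHom_apply_injective [Infinite K] :
    ∃ θ : B, Function.Injective fun p : B →ₐ[K] Ω => p θ :=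
  exists_apply_injective (φ := fun p : B →ₐ[K] Ω => p.toLinearMap) AlgHom.toLinearMap_injective

theorem exists_apply_aeval_eq [IsGalois K Ω] {θ : B}
    (hθ : Function.Injective fun p : B →ₐ[K] Ω => p θ) {c : (B →ₐ[K] Ω) → Ω}
    (hc : ∀ (σ : Ω ≃ₐ[K] Ω) (p : B →ₐ[K] Ω), c ((σ : Ω →ₐ[K] Ω).comp p) = σ (c p)) :
    ∃ g : Polynomial K, ∀ p : B →ₐ[K] Ω, p (Polynomial.aeval θ g) = c p := by
  classical
  have := Fintype.ofFinite (B →ₐ[K] Ω)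
  have hinj : Set.InjOn (fun p : B →ₐ[K] Ω => p θ) (Finset.univ : Finset (B →ₐ[K] Ω)) := hθ.injOn
  let f := Lagrange.interpolate Finset.univ (fun p : B →ₐ[K] Ω => p θ) c
  have hf (p) : f.eval (p θ) = c p := Lagrange.eval_interpolate_at_node c hinj (Finset.mem_univ p)
  obtain ⟨g, hg : g.map (algebraMap K Ω) = f⟩ := exists_map_eq_of_forall_map_eq (K := K) fun σ => by
    refine Lagrange.eq_interpolate_of_eval_eq c hinj
      (Polynomial.degree_map_le.trans_lt (Lagrange.degree_interpolate_lt c hinj)) fun p _ => ?_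
    let q : B →ₐ[K] Ω := (σ.symm : Ω →ₐ[K] Ω).comp p
    have hp : p = (σ : Ω →ₐ[K] Ω).comp q := by ext; simp [q]
    have hpθ : p θ = (σ : Ω →+* Ω) (q θ) := congrArg (· θ) hp
    rw [hpθ, Polynomial.eval_map_apply, hf, hp]
    exact (hc σ q).symm
  refine ⟨g, fun p => ?_⟩
  rw [← Polynomial.aeval_algHom_apply, ← Polynomial.eval_map_algebraMap, hg, hf]

theorem exists_forall_apply_eq [Infinite K] [IsGalois K Ω] {c : (B →ₐ[K] Ω) → Ω}
    (hc : ∀ (σ : Ω ≃ₐ[K] Ω) (p : B →ₐ[K] Ω), c ((σ : Ω →ₐ[K] Ω).comp p) = σ (c p)) :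
    ∃ b : B, ∀ p : B →ₐ[K] Ω, p b = c p := by
  obtain ⟨θ, hθ⟩ := exists_algHom_apply_injective (K := K) (B := B) (Ω := Ω)
  obtain ⟨g, hg⟩ := exists_apply_aeval_eq hθ hc
  exact ⟨_, hg⟩

theorem adjoin_singleton_eq_top [IsReduced B] [IsAlgClosed Ω] [IsGalois K Ω] {θ : B}
    (hθ : Function.Injective fun p : B →ₐ[K] Ω => p θ) : Algebra.adjoin K {θ} = ⊤ := by
  refine eq_top_iff.mpr fun b _ => ?_
  obtain ⟨g, hg⟩ := exists_apply_aeval_eq hθ (c := fun p => p b) fun σ p => rfl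
  have hgb : Polynomial.aeval θ g = b := sub_eq_zero.mp <|
    eq_zero_of_forall_algHom (K := K) (Ω := Ω) fun p => by rw [map_sub, hg, sub_self]
  exact hgb ▸ Polynomial.aeval_mem_adjoin_singleton K θ

theorem exists_adjoin_singleton_eq_top [CharZero K] [IsReduced B] :
    ∃ θ : B, Algebra.adjoin K {θ} = ⊤ := by
  obtain ⟨θ, hθ⟩ := exists_algHom_apply_injective (K := K) (B := B) (Ω := AlgebraicClosure K)
  exact ⟨θ, adjoin_singleton_eq_top hθ⟩

end FiniteAlgebra

section Monogenic

theorem nonempty_algEquiv_adjoinRoot {R T : Type*} [CommRing R] [CommRing T] [Algebra R T] {x : T}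
    (hx : Algebra.adjoin R {x} = ⊤) {f : Polynomial R}
    (hf : RingHom.ker (Polynomial.aeval x : Polynomial R →ₐ[R] T) = Ideal.span {f}) :
    Nonempty (AdjoinRoot f ≃ₐ[R] T) := by
  rw [Algebra.adjoin_singleton_eq_range_aeval] at hx
  exact ⟨(Ideal.quotientEquivAlgOfEq R hf.symm).trans
    (Ideal.quotientKerAlgEquivOfSurjective (AlgHom.range_eq_top _ |>.mp hx))⟩

theorem exists_monic_map_eq_minpoly {R : Type*} (K : Type*) {B : Type*} [CommRing R]
    [IsIntegrallyClosed R] [Field K] [Algebra R K] [IsFractionRing R K] [CommRing B] [Algebra R B]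
    [Algebra K B] [IsScalarTower R K B] {θ : B} (hθ : IsIntegral R θ) :
    ∃ f : Polynomial R, f.Monic ∧ f.map (algebraMap R K) = minpoly K θ ∧
      RingHom.ker (Polynomial.aeval θ : Polynomial R →ₐ[R] B) = Ideal.span {f} := by
  have hinj := IsFractionRing.injective R K
  have hmonic := minpoly.monic (hθ.tower_top (A := K))
  obtain ⟨f, hf⟩ := IsIntegrallyClosed.eq_map_mul_C_of_dvd K (minpoly.monic hθ)
    (minpoly.dvd_map_of_isScalarTower R K θ)
  rw [hmonic.leadingCoeff, map_one, mul_one] at hf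
  have hfmonic : f.Monic := Polynomial.monic_of_injective hinj (hf ▸ hmonic)
  refine ⟨f, hfmonic, hf, Ideal.ext fun g => ?_⟩
  rw [RingHom.mem_ker, Ideal.mem_span_singleton, ← Polynomial.map_dvd_map _ hinj hfmonic, hf,
    minpoly.dvd_iff, Polynomial.aeval_map_algebraMap]

theorem separable_minpoly {K B : Type*} [Field K] [PerfectField K] [CommRing B] [IsReduced B]
    [Algebra K B] {θ : B} (hθ : IsIntegral K θ) : (minpoly K θ).Separable :=
  PerfectField.separable_iff_squarefree.mpr
    ((minpoly.isRadical K θ).squarefree (minpoly.ne_zero hθ))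

end Monogenic

section Discriminant

variable {R : Type*} [CommRing R] {f : Polynomial R}

theorem resultant_derivative_ne_zero {K : Type*} [Field K] [Algebra R K] [FaithfulSMul R K]
    (hf : f.Monic) (hsep : (f.map (algebraMap R K)).Separable) :
    f.resultant f.derivative ≠ 0 := fun h => by
  have hinj := FaithfulSMul.algebraMap_injective R K
  refine ((Polynomial.isUnit_resultant_iff_isCoprime (hf.map _)).mpr hsep).ne_zero ?_
  rw [Polynomial.derivative_map, Polynomial.natDegree_map_eq_of_injective hinj,
    Polynomial.natDegree_map_eq_of_injective hinj, Polynomial.resultant_map_map, h, map_zero]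

theorem separable_map_of_isUnit_resultant {T : Type*} [CommRing T] (φ : R →+* T) (hf : f.Monic)
    (hunit : IsUnit (φ (f.resultant f.derivative))) : (f.map φ).Separable := by
  by_cases hdeg : f.natDegree = 0
  · rw [hf.natDegree_eq_zero.mp hdeg, Polynomial.map_one]
    exact Polynomial.separable_one
  obtain ⟨a, b, -, -, hab⟩ :=
    Polynomial.exists_mul_add_mul_eq_C_resultant f f.derivative le_rfl le_rfl (.inl hdeg)
  obtain ⟨c, hc⟩ := isUnit_iff_exists_inv'.mp hunit
  refine ⟨.C c * a.map φ, .C c * b.map φ, ?_⟩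
  calc .C c * a.map φ * f.map φ + .C c * b.map φ * (f.map φ).derivative
      = .C c * (f * a + f.derivative * b).map φ := by
        rw [Polynomial.derivative_map, Polynomial.map_add, Polynomial.map_mul, Polynomial.map_mul]
        ring
    _ = 1 := by rw [hab, Polynomial.map_C, ← map_mul, hc, map_one]

theorem etale_adjoinRoot (hf : f.Monic) (hsep : f.Separable) : Algebra.Etale R (AdjoinRoot f) := by
  obtain ⟨a, b, hab⟩ := hsep
  let P : StandardEtalePair R := ⟨f, hf, 1, b, a, 1, by rw [one_pow, ← hab]; ring⟩
  have hroot : P.HasMap (AdjoinRoot.root f) := ⟨by simp [P], by simp [P]⟩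
  have hX : f.eval₂ (Algebra.ofId R P.Ring) P.X = 0 := P.hasMap_X.1
  refine Algebra.Etale.of_equiv (A := P.Ring) (AlgEquiv.ofAlgHom (P.lift (AdjoinRoot.root f) hroot)
    (AdjoinRoot.liftAlgHom f (Algebra.ofId R P.Ring) P.X hX) ?_ ?_)
  · refine AdjoinRoot.algHom_ext ?_
    rw [AlgHom.comp_apply, AdjoinRoot.liftAlgHom_root, P.lift_X, AlgHom.id_apply]
  · refine P.hom_ext ?_
    rw [AlgHom.comp_apply, P.lift_X, AdjoinRoot.liftAlgHom_root, AlgHom.id_apply]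

theorem etale_tensorProduct_adjoinRoot {T : Type*} [CommRing T] [Algebra R T] (hf : f.Monic)
    (hsep : (f.map (algebraMap R T)).Separable) : Algebra.Etale T (T ⊗[R] AdjoinRoot f) := by
  let e : T ⊗[R] R ≃ₐ[T] T := Algebra.TensorProduct.rid R T T
  let q := f.map (Algebra.TensorProduct.includeRight : R →ₐ[R] T ⊗[R] R).toRingHom
  have hq : q = (f.map (algebraMap R T)).map (e.symm : T →+* T ⊗[R] R) := by
    ext n
    simp [q, e, Algebra.algebraMap_eq_smul_one, TensorProduct.smul_tmul]
  have : Algebra.Etale T (T ⊗[R] R) := Algebra.Etale.of_equiv e.symm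
  have : Algebra.Etale (T ⊗[R] R) (AdjoinRoot q) :=
    etale_adjoinRoot (hf.map _) (hq ▸ hsep.map)
  have : Algebra.Etale T (AdjoinRoot q) := Algebra.Etale.comp T (T ⊗[R] R) (AdjoinRoot q)
  exact Algebra.Etale.of_equiv (AdjoinRoot.tensorAlgEquiv f q rfl).symm

theorem etale_tensorProduct_of_adjoin_eq_top {S T : Type*} [CommRing S] [Algebra R S] [CommRing T]
    [Algebra R T] {x : S} (hx : Algebra.adjoin R {x} = ⊤) (hf : f.Monic)
    (hker : RingHom.ker (Polynomial.aeval x : Polynomial R →ₐ[R] S) = Ideal.span {f})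
    (hsep : (f.map (algebraMap R T)).Separable) : Algebra.Etale T (T ⊗[R] S) := by
  have := etale_tensorProduct_adjoinRoot hf hsep
  obtain ⟨e⟩ := nonempty_algEquiv_adjoinRoot hx hker
  exact Algebra.Etale.of_equiv (A := T ⊗[R] AdjoinRoot f)
    (Algebra.TensorProduct.congr AlgEquiv.refl e)

end Discriminant

section Model

variable {K : Type u} [Field K] {Kbar : Type v} [Field Kbar] [Algebra K Kbar]

theorem algebraMap_ringOfIntegers_injective :
    Function.Injective (algebraMap (𝓞 K) Kbar) := by
  rw [IsScalarTower.algebraMap_eq (𝓞 K) K Kbar]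
  exact (algebraMap K Kbar).injective.comp NumberField.RingOfIntegers.coe_injective

theorem isIntegrallyClosed_ringOfIntegers [IsFractionRing (𝓞 K) K] : IsIntegrallyClosed (𝓞 K) :=
  (isIntegrallyClosed_iff K).mpr fun {x} hx =>
    IsIntegralClosure.isIntegral_iff.mp (isIntegral_trans (R := ℤ) (A := 𝓞 K) x hx)

theorem PlaceOver.notMem_of_inv_mem {𝔭 : Ideal (𝓞 K)} (P : PlaceOver Kbar 𝔭) {x : 𝓞 K} (hx : x ≠ 0)
    (h : (algebraMap (𝓞 K) Kbar x)⁻¹ ∈ P.ring) : x ∉ 𝔭 := by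
  rw [← P.mem_iff, ValuationSubring.mem_nonunits_iff_or, not_or, not_not]
  exact ⟨(map_ne_zero_iff _ algebraMap_ringOfIntegers_injective).mpr hx, h⟩

theorem eventually_notMem {x : 𝓞 K} (hx : x ≠ 0) :
    ∀ᶠ P in almostAllPlaces K Kbar, x ∉ P.1 := by
  filter_upwards [eventually_place (eventually_mem (algebraMap (𝓞 K) Kbar x)⁻¹)] with P hP
  exact P.2.notMem_of_inv_mem hx hP

variable {B : Type w} [CommRing B] [Algebra K B]

theorem exists_integralModel_adjoin_eq_top [CharZero K] [IsFractionRing (𝓞 K) K]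
    [Module.Finite K B] [IsReduced B] :
    ∃ (M : IntegralModel K B) (θ : M.order), Algebra.adjoin (𝓞 K) {θ} = ⊤ := by
  obtain ⟨θ₀, hθ₀⟩ := exists_adjoin_singleton_eq_top (K := K) (B := B)
  have halg : IsAlgebraic (𝓞 K) θ₀ :=
    (IsFractionRing.isAlgebraic_iff (𝓞 K) K B).mpr (Algebra.IsAlgebraic.isAlgebraic θ₀)
  obtain ⟨y, hy, hintegral⟩ := halg.exists_integral_multiple
  have hy' : algebraMap (𝓞 K) K y ≠ 0 :=
    (map_ne_zero_iff _ algebraMap_ringOfIntegers_injective).mpr hy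
  have hθ : Algebra.adjoin K {y • θ₀} = ⊤ := by
    rw [← top_le_iff, ← hθ₀]
    refine Algebra.adjoin_singleton_le ?_
    convert Subalgebra.smul_mem _ (Algebra.self_mem_adjoin_singleton K (y • θ₀))
      (algebraMap (𝓞 K) K y)⁻¹ using 1
    rw [← algebraMap_smul K y, inv_smul_smul₀ hy']
  refine ⟨⟨Algebra.adjoin (𝓞 K) {y • θ₀}, Algebra.finite_adjoin_simple_of_isIntegral hintegral, ?_⟩,
    ⟨y • θ₀, Algebra.self_mem_adjoin_singleton _ _⟩, ?_⟩
  · refine top_le_iff.mp ?_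
    rw [← Algebra.top_toSubmodule (R := K), ← hθ, Algebra.adjoin_eq_span]
    exact Submodule.span_mono
      (Submonoid.closure_le (S := (Algebra.adjoin (𝓞 K) {y • θ₀}).toSubmonoid).mpr
        Algebra.subset_adjoin)
  · convert Algebra.adjoin_adjoin_coe_preimage (R := 𝓞 K) (s := {y • θ₀}) using 2
    ext b
    simp [Subtype.ext_iff]

variable {M : IntegralModel K B} {θ : M.order}

theorem IntegralModel.adjoin_coe_eq_top (hθ : Algebra.adjoin (𝓞 K) {θ} = ⊤) :
    Algebra.adjoin K {(θ : B)} = ⊤ := by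
  have horder : (M.order : Set B) ⊆ Algebra.adjoin K {(θ : B)} := fun b hb => by
    have hb' : (⟨b, hb⟩ : M.order) ∈ Algebra.adjoin (𝓞 K) {θ} := hθ ▸ Algebra.mem_top
    rw [Algebra.adjoin_singleton_eq_range_aeval] at hb'
    obtain ⟨g, hg⟩ := hb'
    have hg' : Polynomial.aeval (θ : B) g = b := by
      rw [← Subalgebra.coe_val, Polynomial.aeval_algHom_apply]
      exact congrArg Subtype.val hg
    rw [← hg', ← Polynomial.aeval_map_algebraMap K]
    exact Polynomial.aeval_mem_adjoin_singleton K _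
  refine eq_top_iff.mpr fun b _ => ?_
  have hb : b ∈ Submodule.span K (M.order : Set B) := M.span_eq_top ▸ Submodule.mem_top
  exact Submodule.span_le (p := (Algebra.adjoin K {(θ : B)}).toSubmodule) |>.mpr horder hb

theorem IntegralModel.exists_smul_mem_order [IsFractionRing (𝓞 K) K] (M : IntegralModel K B)
    (b : B) : ∃ N : 𝓞 K, N ≠ 0 ∧ N • b ∈ M.order := by
  have hb : b ∈ Submodule.span K (M.order : Set B) := M.span_eq_top ▸ Submodule.mem_top
  obtain ⟨N, hN⟩ := multiple_mem_span_of_mem_localization_span (nonZeroDivisors (𝓞 K)) K _ b hb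
  rw [show Submodule.span (𝓞 K) (M.order : Set B) = M.order.toSubmodule from
    Submodule.span_eq M.order.toSubmodule] at hN
  exact ⟨N, nonZeroDivisors.ne_zero N.2, hN⟩

theorem IntegralModel.eventually_isSmoothAt [CharZero K] [IsFractionRing (𝓞 K) K] [IsReduced B]
    (hθ : Algebra.adjoin (𝓞 K) {θ} = ⊤) :
    ∀ᶠ P : Place K Kbar in almostAllPlaces K Kbar, ∀ [P.1.IsPrime], M.IsSmoothAt P.1 := by
  have := isIntegrallyClosed_ringOfIntegers (K := K)
  have := M.finite
  have hint : IsIntegral (𝓞 K) (θ : B) := (Algebra.IsIntegral.isIntegral θ).map M.order.val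
  obtain ⟨f, hf, hfmin, hker⟩ := exists_monic_map_eq_minpoly K hint
  have hsep : (f.map (algebraMap (𝓞 K) K)).Separable := hfmin ▸ separable_minpoly hint.tower_top
  have hkerθ : RingHom.ker (Polynomial.aeval θ : Polynomial (𝓞 K) →ₐ[𝓞 K] M.order) =
      Ideal.span {f} := by
    rw [← hker]
    ext g
    rw [RingHom.mem_ker, RingHom.mem_ker, ← Subalgebra.coe_val, Polynomial.aeval_algHom_apply,
      Subalgebra.coe_val, ZeroMemClass.coe_eq_zero]
  filter_upwards [eventually_notMem (resultant_derivative_ne_zero hf hsep)] with P hP _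
  have hunit := IsLocalization.map_units (Localization.AtPrime P.1)
    (⟨f.resultant f.derivative, hP⟩ : P.1.primeCompl)
  have := etale_tensorProduct_of_adjoin_eq_top hθ hf hkerθ
    (separable_map_of_isUnit_resultant _ hf hunit)
  exact inferInstanceAs (Algebra.Smooth _ _)

end Model

section GeometricPoints

theorem splits_of_monic {A : Type*} (Ω : Type*) [CommRing A] [IsIntegrallyClosed A]
    [Field Ω] [IsAlgClosed Ω] [Algebra A Ω] [IsFractionRing A Ω] {f : Polynomial A}
    (hf : f.Monic) : f.Splits := by
  refine Polynomial.Splits.of_splits_map_of_injective (IsFractionRing.injective A Ω)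
    (IsAlgClosed.splits _) fun a ha => ?_
  have haroot : f.eval₂ (algebraMap A Ω) a = 0 := by
    rw [← Polynomial.eval_map]
    exact Polynomial.isRoot_of_mem_roots ha
  exact IsIntegrallyClosed.isIntegral_iff.mp ⟨f, hf, haroot⟩

theorem exists_isRoot_map_eq {A k : Type*} [CommRing A] [IsDomain A] [CommRing k] [IsDomain k]
    {f : Polynomial A} (hf : f.Monic) (hsplits : f.Splits) (φ : A →+* k) {y : k}
    (hy : (f.map φ).IsRoot y) : ∃ x, f.IsRoot x ∧ φ x = y := by
  have hmem : y ∈ (f.map φ).roots := (Polynomial.mem_roots (hf.map φ).ne_zero).mpr hy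
  rw [hsplits.roots_map_of_ne_zero (hf.map φ).ne_zero, Multiset.mem_map] at hmem
  obtain ⟨x, hx, hxy⟩ := hmem
  exact ⟨x, Polynomial.isRoot_of_mem_roots hx, hxy⟩

theorem exists_algHom_apply_eq {K B Ω : Type*} [Field K] [CommRing B] [Algebra K B] [CommRing Ω]
    [Algebra K Ω] {θ : B} (hθ : Algebra.adjoin K {θ} = ⊤) {a : Ω}
    (ha : Polynomial.aeval a (minpoly K θ) = 0) : ∃ p : B →ₐ[K] Ω, p θ = a := by
  let e : Algebra.adjoin K {θ} ≃ₐ[K] B := (Subalgebra.equivOfEq _ _ hθ).trans Subalgebra.topEquiv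
  let e' : Algebra.adjoin K {θ} ≃ₐ[K] AdjoinRoot (minpoly K θ) :=
    AlgEquiv.adjoinSingletonEquivAdjoinRootMinpoly K θ
  have heθ : e' (e.symm θ) = AdjoinRoot.root (minpoly K θ) := by
    rw [← AlgEquiv.eq_symm_apply, e.symm_apply_eq,
      AlgEquiv.coe_adjoinSingletonEquivAdjoinRootMinpoly_symm, ← AdjoinRoot.mk_X]
    exact (AdjoinRoot.Minpoly.coe_toAdjoin_mk_X).symm
  refine ⟨(AdjoinRoot.liftAlgHom _ (Algebra.ofId K Ω) a ha).comp (e.symm.trans e'), ?_⟩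
  rw [AlgHom.comp_apply, AlgEquiv.coe_toAlgHom, AlgEquiv.trans_apply, heθ]
  exact AdjoinRoot.liftAlgHom_root _ _ _ _

variable {K : Type u} [Field K] {Kbar : Type v} [Field Kbar] [Algebra K Kbar]
  {B : Type w} [CommRing B] [Algebra K B] {M : IntegralModel K B} {θ : M.order} {𝔭 : Ideal (𝓞 K)}
  (P : PlaceOver Kbar 𝔭)

theorem IntegralModel.reducePoint_one_tmul (p : B →ₐ[K] Kbar) (b : M.order) :
    M.reducePoint P p (1 ⊗ₜ b) = IsLocalRing.residue P.ring (M.restrict P p b) := by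
  rw [IntegralModel.reducePoint, Algebra.TensorProduct.lift_tmul, map_one, one_mul]
  rfl

theorem IntegralModel.fibre_algHom_ext (hθ : Algebra.adjoin (𝓞 K) {θ} = ⊤) {k : Type*} [CommRing k]
    [Algebra (𝓞 K ⧸ 𝔭) k] {q q' : M.Fibre 𝔭 →ₐ[𝓞 K ⧸ 𝔭] k}
    (h : q (1 ⊗ₜ θ) = q' (1 ⊗ₜ θ)) : q = q' := by
  let _ : Algebra (𝓞 K) k := Algebra.compHom k (Ideal.Quotient.mk 𝔭)
  have : IsScalarTower (𝓞 K) (𝓞 K ⧸ 𝔭) k := IsScalarTower.of_algebraMap_eq fun _ => rfl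
  refine Algebra.TensorProduct.ext (by ext) (AlgHom.ext_of_adjoin_eq_top hθ ?_)
  simpa using h

theorem IntegralModel.reducePoint_surjective [IsAlgClosed Kbar] [IsFractionRing (𝓞 K) K]
    (hθ : Algebra.adjoin (𝓞 K) {θ} = ⊤) :
    Function.Surjective (M.reducePoint (Kbar := Kbar) P) := fun q => by
  have := isIntegrallyClosed_ringOfIntegers (K := K)
  have := M.finite
  have hint : IsIntegral (𝓞 K) (θ : B) := (Algebra.IsIntegral.isIntegral θ).map M.order.val
  obtain ⟨f, hf, hfmin, hker⟩ := exists_monic_map_eq_minpoly K hint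
  have hfθ : Polynomial.aeval θ f = 0 := Subtype.ext <| by
    have hf : f ∈ Ideal.span {f} := Ideal.mem_span_singleton_self f
    rw [← hker, RingHom.mem_ker, ← Subalgebra.coe_val, Polynomial.aeval_algHom_apply] at hf
    exact hf
  let q₀ : M.order →ₐ[𝓞 K] P.Residue :=
    (q.restrictScalars (𝓞 K)).comp Algebra.TensorProduct.includeRight
  have hroot : ((f.map (algebraMap (𝓞 K) P.ring)).map (IsLocalRing.residue P.ring)).IsRoot
      (q₀ θ) := by
    rw [Polynomial.map_map, ← IsLocalRing.ResidueField.algebraMap_eq,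
      ← IsScalarTower.algebraMap_eq, Polynomial.IsRoot, Polynomial.eval_map_algebraMap,
      Polynomial.aeval_algHom_apply, hfθ, map_zero]
  obtain ⟨a, ha, haq⟩ := exists_isRoot_map_eq (hf.map _) (splits_of_monic Kbar (hf.map _)) _ hroot
  have haK : Polynomial.aeval (a : Kbar) (minpoly K (θ : B)) = 0 := by
    have : IsScalarTower (𝓞 K) P.ring Kbar := IsScalarTower.of_algebraMap_eq fun _ => rfl
    rw [Polynomial.IsRoot, Polynomial.eval_map_algebraMap] at ha
    rw [← hfmin, Polynomial.aeval_map_algebraMap]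
    exact (Polynomial.aeval_algebraMap_apply Kbar a f).trans (by rw [ha, map_zero])
  obtain ⟨p, hp⟩ := exists_algHom_apply_eq (IntegralModel.adjoin_coe_eq_top hθ) haK
  refine ⟨p, IntegralModel.fibre_algHom_ext hθ ?_⟩
  rw [IntegralModel.reducePoint_one_tmul, show M.restrict P p θ = a from Subtype.ext hp, haq]
  rfl

theorem IntegralModel.reducePoint_injective (hθ : Algebra.adjoin (𝓞 K) {θ} = ⊤)
    (hP : ∀ p q : B →ₐ[K] Kbar, (p θ - q θ)⁻¹ ∈ P.ring) :
    Function.Injective (M.reducePoint (Kbar := Kbar) P) := fun p q hpq => by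
  have hres := DFunLike.congr_fun hpq (1 ⊗ₜ θ)
  rw [IntegralModel.reducePoint_one_tmul, IntegralModel.reducePoint_one_tmul, ← sub_eq_zero,
    ← map_sub, IsLocalRing.residue_eq_zero_iff, IsLocalRing.mem_maximalIdeal,
    mem_nonunits_iff] at hres
  refine AlgHom.ext_of_adjoin_eq_top (IntegralModel.adjoin_coe_eq_top hθ) ?_
  rintro _ rfl
  by_contra hne
  exact hres (IsUnit.of_mul_eq_one ⟨_, hP p q⟩
    (Subtype.ext (mul_inv_cancel₀ (sub_ne_zero.mpr hne))))

theorem IntegralModel.eventually_reducePoint_bijective [IsAlgClosed Kbar]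
    [IsFractionRing (𝓞 K) K] [Module.Finite K B] (hθ : Algebra.adjoin (𝓞 K) {θ} = ⊤) :
    ∀ᶠ P : Place K Kbar in almostAllPlaces K Kbar,
      Function.Bijective (M.reducePoint (Kbar := Kbar) P.2) := by
  filter_upwards [eventually_place (eventually_forall_mem
    fun pq : (B →ₐ[K] Kbar) × (B →ₐ[K] Kbar) => (pq.1 θ - pq.2 θ)⁻¹)] with P hP
  exact ⟨IntegralModel.reducePoint_injective P.2 hθ fun p q => hP (p, q),
    IntegralModel.reducePoint_surjective P.2 hθ⟩

end GeometricPoints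

section Equivariance

variable {K : Type u} [Field K] {Kbar : Type v} [Field Kbar] [Algebra K Kbar]

theorem PlaceOver.algebraMap_residue_ne_zero {𝔭 : Ideal (𝓞 K)} (P : PlaceOver Kbar 𝔭) {x : 𝓞 K}
    (hx : x ∉ 𝔭) : algebraMap (𝓞 K) P.Residue x ≠ 0 := fun h => by
  rw [IsScalarTower.algebraMap_apply (𝓞 K) P.ring P.Residue, IsLocalRing.ResidueField.algebraMap_eq,
    IsLocalRing.residue_eq_zero_iff] at h
  exact hx ((P.mem_iff x).mp (ValuationSubring.mem_nonunits_iff_exists_mem_maximalIdeal.mpr ⟨_, h⟩))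

variable {B : Type w} [CommRing B] [Algebra K B] [Module.Finite K B]

theorem IntegralModel.eventually_residue_equivariant [IsFractionRing (𝓞 K) K] [Infinite K]
    [IsGalois K Kbar] (M : IntegralModel K B) {c : (B →ₐ[K] Kbar) → Kbar}
    (hc : ∀ (σ : Kbar ≃ₐ[K] Kbar) (p : B →ₐ[K] Kbar), c ((σ : Kbar →ₐ[K] Kbar).comp p) = σ (c p)) :
    ∀ᶠ P : Place K Kbar in almostAllPlaces K Kbar,
      ∀ (a : (B →ₐ[K] Kbar) → P.2.ring) (_ : ∀ p, (a p : Kbar) = c p)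
        (τ : P.2.Residue ≃ₐ[𝓞 K ⧸ P.1] P.2.Residue) (p p' : B →ₐ[K] Kbar),
        M.reducePoint P.2 p' = (τ : P.2.Residue →ₐ[𝓞 K ⧸ P.1] P.2.Residue).comp
          (M.reducePoint P.2 p) →
        IsLocalRing.residue P.2.ring (a p') = τ (IsLocalRing.residue P.2.ring (a p)) := by
  obtain ⟨b, hb⟩ := exists_forall_apply_eq hc
  obtain ⟨N, hN, hNb⟩ := M.exists_smul_mem_order b
  filter_upwards [eventually_notMem hN] with ⟨𝔭, P⟩ hP a ha τ p p' hpp'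
  have hred : ∀ p, M.reducePoint P p (1 ⊗ₜ ⟨N • b, hNb⟩) =
      algebraMap (𝓞 K) P.Residue N * IsLocalRing.residue P.ring (a p) := fun p => by
    rw [M.reducePoint_one_tmul, IsScalarTower.algebraMap_apply (𝓞 K) P.ring P.Residue,
      IsLocalRing.ResidueField.algebraMap_eq, ← map_mul]
    refine congrArg _ (Subtype.ext ?_)
    change p (N • b) = algebraMap (𝓞 K) Kbar N * a p
    rw [ha, ← hb, ← Algebra.smul_def]
    exact map_smul (p.restrictScalars (𝓞 K)) N b
  refine mul_left_cancel₀ (P.algebraMap_residue_ne_zero hP) ?_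
  have hN' : τ (algebraMap (𝓞 K) P.Residue N) = algebraMap (𝓞 K) P.Residue N :=
    (τ.restrictScalars (𝓞 K)).commutes N
  rw [← hred, hpp', AlgHom.comp_apply, hred, AlgEquiv.coe_toAlgHom, map_mul, hN']

theorem IntegralModel.eventually_reduce_equivariant [IsFractionRing (𝓞 K) K] [Infinite K]
    [IsGalois K Kbar] (M : IntegralModel K B)
    {η : (B →ₐ[K] Kbar) → Submodule Kbar (Fin 4 → Kbar)} (hη : IsEquivariant η) :
    ∀ᶠ P : Place K Kbar in almostAllPlaces K Kbar,
      ∀ (τ : P.2.Residue ≃ₐ[𝓞 K ⧸ P.1] P.2.Residue) (p p' : B →ₐ[K] Kbar),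
        M.reducePoint P.2 p' = (τ : P.2.Residue →ₐ[𝓞 K ⧸ P.1] P.2.Residue).comp
          (M.reducePoint P.2 p) →
        P.2.reduce (η p') = galConj τ (P.2.reduce (η p)) := by
  have hframe : ∀ (j i : Fin 4) (σ : Kbar ≃ₐ[K] Kbar) (p : B →ₐ[K] Kbar),
      frame (η ((σ : Kbar →ₐ[K] Kbar).comp p)) j i = σ (frame (η p) j i) := fun j i σ p => by
    rw [isEquivariant_iff_galConj.mp hη, frame_galConj]
  filter_upwards [Filter.eventually_all.mpr fun j => Filter.eventually_all.mpr fun i =>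
      M.eventually_residue_equivariant (c := fun p => frame (η p) j i) (hframe j i),
    eventually_place (eventually_forall_mem
      fun x : (B →ₐ[K] Kbar) × Fin 4 × Fin 4 => frame (η x.1) x.2.1 x.2.2)]
    with ⟨𝔭, P⟩ hequiv hmem τ p p' hpp'
  let a (p : B →ₐ[K] Kbar) (j i : Fin 4) : P.ring := ⟨frame (η p) j i, hmem (p, j, i)⟩
  have ha : ∀ p, IsFrame (P.reduce (η p)) (pivotSet (η p))
      fun j i => IsLocalRing.residue P.ring (a p j i) := fun p =>
    IsFrame.reduceAt (isFrame_frame (η p))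
  rw [← (ha p').span_range_eq, ← ((ha p).galConj τ).span_range_eq]
  refine congrArg (Submodule.span P.Residue <| Set.range ·) (funext₂ fun j i => ?_)
  exact hequiv j i (a · j i) (fun _ => rfl) τ p p' hpp'

end Equivariance

section QuarticReduction

theorem exists_map_eq_C_mul {R K σ : Type*} [CommRing R] [Field K] [Algebra R K]
    [IsFractionRing R K] (F : MvPolynomial σ K) :
    ∃ (G : MvPolynomial σ R) (D : R), D ≠ 0 ∧
      MvPolynomial.map (algebraMap R K) G = MvPolynomial.C (algebraMap R K D) * F := by
  have := (algebraMap R K).domain_nontrivial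
  let _ : Algebra (MvPolynomial σ R) (MvPolynomial σ K) := MvPolynomial.algebraMvPolynomial
  obtain ⟨⟨G, s⟩, hGs⟩ :=
    IsLocalization.surj ((nonZeroDivisors R).map (MvPolynomial.C (σ := σ))) F
  obtain ⟨D, hD, hDs⟩ := Submonoid.mem_map.mp s.2
  refine ⟨G, D, nonZeroDivisors.ne_zero hD, ?_⟩
  rw [MvPolynomial.algebraMap_def] at hGs
  rw [← hGs, ← hDs, MvPolynomial.map_C, mul_comm]

theorem exists_C_mul_X_pow_mem_span {R K Ω σ o : Type*} [CommRing R] [Field K] [Algebra R K]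
    [IsFractionRing R K] [Field Ω] [IsAlgClosed Ω] [Algebra K Ω] [Algebra R Ω]
    [IsScalarTower R K Ω] [Finite σ] {G : o → MvPolynomial σ R}
    (hG : ∀ x : σ → Ω, (∀ m, MvPolynomial.aeval x (G m) = 0) → x = 0) (i : σ) :
    ∃ N : R, N ≠ 0 ∧
      ∃ n : ℕ, MvPolynomial.C N * MvPolynomial.X i ^ n ∈ Ideal.span (Set.range G) := by
  have hX : MvPolynomial.X i ∈
      ((Ideal.span (Set.range G)).map (MvPolynomial.map (algebraMap R K))).radical := by
    rw [← MvPolynomial.vanishingIdeal_zeroLocus_eq_radical (K := Ω),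
      MvPolynomial.mem_vanishingIdeal_iff]
    intro x hx
    have hx0 : x = 0 := hG x fun m => by
      rw [← MvPolynomial.aeval_map_algebraMap K]
      exact hx _ (Ideal.mem_map_of_mem _ (Ideal.subset_span ⟨m, rfl⟩))
    rw [MvPolynomial.aeval_X, hx0, Pi.zero_apply]
  obtain ⟨n, hn⟩ := hX
  have := (algebraMap R K).domain_nontrivial
  let _ : Algebra (MvPolynomial σ R) (MvPolynomial σ K) := MvPolynomial.algebraMvPolynomial
  rw [← MvPolynomial.algebraMap_def, IsLocalization.mem_map_algebraMap_iff
    ((nonZeroDivisors R).map (MvPolynomial.C (σ := σ)))] at hn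
  obtain ⟨⟨⟨a, ha⟩, s⟩, has⟩ := hn
  obtain ⟨N, hN, hNs⟩ := Submonoid.mem_map.mp s.2
  refine ⟨N, nonZeroDivisors.ne_zero hN, n, ?_⟩
  have haN : a = MvPolynomial.C N * MvPolynomial.X i ^ n := by
    refine MvPolynomial.map_injective _ (IsFractionRing.injective R K) ?_
    rw [MvPolynomial.algebraMap_def] at has
    rw [← has, map_mul, map_pow, MvPolynomial.map_X, ← hNs, mul_comm]
  exact haN ▸ ha

variable {K : Type u} [Field K] {Kbar : Type v} [Field Kbar] [Algebra K Kbar]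

theorem eventually_no_common_zero [IsFractionRing (𝓞 K) K] [IsAlgClosed Kbar] {σ o : Type*}
    [Finite σ] {G : o → MvPolynomial σ (𝓞 K)}
    (hG : ∀ x : σ → Kbar, (∀ m, MvPolynomial.aeval x (G m) = 0) → x = 0) :
    ∀ᶠ P : Place K Kbar in almostAllPlaces K Kbar, ∀ x : σ → P.2.Residue,
      (∀ m, MvPolynomial.aeval x (G m) = 0) → x = 0 := by
  choose N hN n hmem using exists_C_mul_X_pow_mem_span (K := K) hG
  filter_upwards [Filter.eventually_all.mpr fun i => eventually_notMem (hN i)]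
    with ⟨𝔭, P⟩ hP x hx
  funext i
  have hker : Ideal.span (Set.range G) ≤
      RingHom.ker (MvPolynomial.aeval x : MvPolynomial σ (𝓞 K) →ₐ[𝓞 K] P.Residue) := by
    rw [Ideal.span_le]
    rintro _ ⟨m, rfl⟩
    exact hx m
  have hxi := hker (hmem i)
  rw [RingHom.mem_ker, map_mul, map_pow, MvPolynomial.aeval_C, MvPolynomial.aeval_X] at hxi
  exact eq_zero_of_pow_eq_zero
    ((mul_eq_zero.mp hxi).resolve_left (P.algebraMap_residue_ne_zero (hP i)))

/-- The form `F` together with its partial derivatives: the equations of the singular locus. -/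
noncomputable def jacobianForms {k : Type*} [CommRing k] (F : MvPolynomial (Fin 4) k) :
    Option (Fin 4) → MvPolynomial (Fin 4) k :=
  fun m => m.elim F fun i => MvPolynomial.pderiv i F

theorem jacobianForms_map {k l : Type*} [CommRing k] [CommRing l] (φ : k →+* l)
    (F : MvPolynomial (Fin 4) k) (m : Option (Fin 4)) :
    jacobianForms (MvPolynomial.map φ F) m = MvPolynomial.map φ (jacobianForms F m) := by
  cases m with
  | none => rfl
  | some i => exact MvPolynomial.pderiv_map

theorem jacobianForms_C_mul {k : Type*} [CommRing k] (c : k) (F : MvPolynomial (Fin 4) k)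
    (m : Option (Fin 4)) :
    jacobianForms (MvPolynomial.C c * F) m = MvPolynomial.C c * jacobianForms F m := by
  cases m with
  | none => rfl
  | some i => exact MvPolynomial.pderiv_C_mul

theorem isSmoothQuartic_iff {k Ω : Type*} [CommRing k] [Field Ω] [Algebra k Ω]
    {F : MvPolynomial (Fin 4) k} :
    IsSmoothQuartic F Ω ↔ F.IsHomogeneous 4 ∧
      ∀ x : Fin 4 → Ω, (∀ m, MvPolynomial.aeval x (jacobianForms F m) = 0) → x = 0 := by
  refine and_congr_right fun _ => forall_congr' fun x => ?_
  rw [Option.forall]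
  change _ ↔ (MvPolynomial.aeval x F = 0 ∧
    ∀ i, MvPolynomial.aeval x (MvPolynomial.pderiv i F) = 0) → x = 0
  rw [ne_eq, not_imp_comm, Classical.not_imp, not_exists]
  simp only [not_not]

theorem eventually_quarticGoodReduction [IsFractionRing (𝓞 K) K] [IsAlgClosed Kbar]
    {F : MvPolynomial (Fin 4) K} (hF : IsSmoothQuartic F Kbar) :
    ∀ᶠ P : Place K Kbar in almostAllPlaces K Kbar, QuarticGoodReduction F P.2 := by
  obtain ⟨hFhom, hFzero⟩ := isSmoothQuartic_iff.mp hF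
  obtain ⟨G, D, hD, hG⟩ := exists_map_eq_C_mul (R := 𝓞 K) F
  have hinj := IsFractionRing.injective (𝓞 K) K
  have hD' : algebraMap (𝓞 K) K D ≠ 0 := (map_ne_zero_iff _ hinj).mpr hD
  have hGhom : G.IsHomogeneous 4 :=
    MvPolynomial.IsHomogeneous.of_map hinj (hG ▸ hFhom.C_mul _)
  have hGzero : ∀ x : Fin 4 → Kbar,
      (∀ m, MvPolynomial.aeval x (jacobianForms G m) = 0) → x = 0 := fun x hx =>
    hFzero x fun m => by
      have hm := hx m
      rw [← MvPolynomial.aeval_map_algebraMap K, ← jacobianForms_map, hG, jacobianForms_C_mul,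
        map_mul, MvPolynomial.aeval_C] at hm
      exact (mul_eq_zero.mp hm).resolve_left ((map_ne_zero _).mpr hD')
  filter_upwards [eventually_no_common_zero hGzero] with ⟨𝔭, P⟩ hP
  refine ⟨G, algebraMap (𝓞 K) K D, hD', hG,
    isSmoothQuartic_iff.mpr ⟨hGhom.map _, fun x hx => hP x fun m => ?_⟩⟩
  rw [← hx m, jacobianForms_map]
  exact (MvPolynomial.aeval_map_algebraMap (𝓞 K ⧸ 𝔭) x _).symm

end QuarticReduction

section IncidenceGraph

variable {Ω k : Type*} [Field Ω] [Field k] {L : Set (Submodule Ω (Fin 4 → Ω))}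

theorem finite_intersectionPoints (hL : L.Finite) : (intersectionPoints L).Finite := by
  refine (hL.image2 (· ⊓ ·) hL).subset ?_
  rintro q ⟨-, l₁, h₁, l₂, h₂, -, rfl⟩
  exact ⟨l₁, h₁, l₂, h₂, rfl⟩

/-- The map `r` on linear subspaces preserves the configuration of the lines of `L` and of their
intersection points. -/
structure PreservesIncidence (r : Submodule Ω (Fin 4 → Ω) → Submodule k (Fin 4 → k))
    (L : Set (Submodule Ω (Fin 4 → Ω))) : Prop where
  le_iff : ∀ U ∈ L ∪ intersectionPoints L, ∀ W ∈ L ∪ intersectionPoints L, r U ≤ r W ↔ U ≤ W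
  inf : ∀ l₁ ∈ L, ∀ l₂ ∈ L, r (l₁ ⊓ l₂) = r l₁ ⊓ r l₂
  finrank_inf : ∀ l₁ ∈ L, ∀ l₂ ∈ L,
    Module.finrank k (r (l₁ ⊓ l₂)) = Module.finrank Ω ↥(l₁ ⊓ l₂)

namespace PreservesIncidence

variable {r : Submodule Ω (Fin 4 → Ω) → Submodule k (Fin 4 → k)}

theorem injOn (h : PreservesIncidence r L) : Set.InjOn r (L ∪ intersectionPoints L) :=
  fun _ hU _ hW hUW =>
    le_antisymm ((h.le_iff _ hU _ hW).mp hUW.le) ((h.le_iff _ hW _ hU).mp hUW.ge)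

theorem image_intersectionPoints (h : PreservesIncidence r L) :
    r '' intersectionPoints L = intersectionPoints (r '' L) := by
  ext q'
  constructor
  · rintro ⟨_, ⟨hq, l₁, hl₁, l₂, hl₂, hne, rfl⟩, rfl⟩
    exact ⟨(h.finrank_inf l₁ hl₁ l₂ hl₂).trans hq, r l₁, ⟨l₁, hl₁, rfl⟩, r l₂, ⟨l₂, hl₂, rfl⟩,
      h.injOn.ne (Or.inl hl₁) (Or.inl hl₂) hne, h.inf l₁ hl₁ l₂ hl₂⟩
  · rintro ⟨hq', _, ⟨l₁, hl₁, rfl⟩, _, ⟨l₂, hl₂, rfl⟩, hne, rfl⟩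
    rw [← h.inf l₁ hl₁ l₂ hl₂] at hq' ⊢
    exact ⟨_, ⟨(h.finrank_inf l₁ hl₁ l₂ hl₂).symm.trans hq', l₁, hl₁, l₂, hl₂,
      fun he => hne (he ▸ rfl), rfl⟩, rfl⟩

theorem exists_incidenceGraph_iso (h : PreservesIncidence r L)
    {L' : Set (Submodule k (Fin 4 → k))} (hL' : r '' L = L') :
    ∃ φ : incidenceGraph L ≃g incidenceGraph L',
      (∀ q : intersectionPoints L, ∃ q' : intersectionPoints L',
        φ (Sum.inl q) = Sum.inl q' ∧ q'.1 = r q.1) ∧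
      ∀ l : L, ∃ l' : L', φ (Sum.inr l) = Sum.inr l' ∧ l'.1 = r l.1 := by
  have hpoints : Set.BijOn r (intersectionPoints L) (intersectionPoints L') := by
    rw [← hL', ← h.image_intersectionPoints]
    exact (h.injOn.mono Set.subset_union_right).bijOn_image
  have hlines : Set.BijOn r L L' := hL' ▸ (h.injOn.mono Set.subset_union_left).bijOn_image
  refine ⟨⟨(hpoints.equiv r).sumCongr (hlines.equiv r), ?_⟩, fun q => ⟨_, rfl, rfl⟩,
    fun l => ⟨_, rfl, rfl⟩⟩
  rintro (q | l) (q' | l')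
  · exact Iff.rfl
  · exact h.le_iff _ (Or.inr q.2) _ (Or.inl l'.2)
  · exact h.le_iff _ (Or.inr q'.2) _ (Or.inl l.2)
  · exact Iff.rfl

end PreservesIncidence

theorem eventually_preservesIncidence (hL : L.Finite) :
    ∀ᶠ A : ValuationSubring Ω in almostAll Ω, PreservesIncidence (reduceAt A) L := by
  have hfin := hL.union (finite_intersectionPoints hL)
  have hpairs {s : Set (Submodule Ω (Fin 4 → Ω))} (hs : s.Finite)
      {Q : ValuationSubring Ω → Submodule Ω (Fin 4 → Ω) → Submodule Ω (Fin 4 → Ω) → Prop}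
      (hQ : ∀ U W, ∀ᶠ A in almostAll Ω, Q A U W) :
      ∀ᶠ A in almostAll Ω, ∀ U ∈ s, ∀ W ∈ s, Q A U W :=
    hs.eventually_all.mpr fun U _ => hs.eventually_all.mpr fun W _ => hQ U W
  filter_upwards [hpairs hfin eventually_reduceAt_le_iff, hpairs hL eventually_reduceAt_inf,
    hpairs hL fun U W => eventually_finrank_reduceAt (U ⊓ W)] with A hle hinf hrank
  exact ⟨hle, hinf, hrank⟩

end IncidenceGraph

section GoodReductionAlmostEverywhere

variable {K : Type u} [Field K] [CharZero K] {Kbar : Type v} [Field Kbar] [Algebra K Kbar]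
  [IsAlgClosure K Kbar] {F : MvPolynomial (Fin 4) K}

theorem SchemeOfLines.eventually_exists_reduction [IsFractionRing (𝓞 K) K]
    (S : SchemeOfLines F Kbar) {M : IntegralModel K S.B} {θ : M.order}
    (hθ : Algebra.adjoin (𝓞 K) {θ} = ⊤) :
    ∀ᶠ P : Place K Kbar in almostAllPlaces K Kbar,
      ∃ η' : (M.Fibre P.1 →ₐ[𝓞 K ⧸ P.1] P.2.Residue) →
          Submodule P.2.Residue (Fin 4 → P.2.Residue),
        (∀ q, η' q ∈ P.2.reduce '' linesOn F Kbar) ∧ Function.Injective η' ∧ IsEquivariant η' ∧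
        (∀ p : S.B →ₐ[K] Kbar, P.2.reduce (S.η p) = η' (M.reducePoint P.2 p)) ∧
        PreservesIncidence P.2.reduce (Set.range S.η) ∧
        P.2.reduce '' Set.range S.η = Set.range η' := by
  have := IsAlgClosure.isAlgClosed K (K := Kbar)
  have := IsAlgClosure.isGalois K Kbar
  filter_upwards [M.eventually_reducePoint_bijective hθ,
    M.eventually_reduce_equivariant S.equivariant,
    eventually_place (eventually_preservesIncidence (Set.finite_range S.η))]
    with ⟨𝔭, P⟩ hbij hequiv hpres
  let e := Equiv.ofBijective (M.reducePoint P) hbij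
  have he (q) : M.reducePoint P (e.symm q) = q := e.apply_symm_apply q
  have hη : Function.Injective S.η := Set.injOn_univ.mp S.bijOn.injOn
  refine ⟨fun q => P.reduce (S.η (e.symm q)), fun q => ⟨_, S.bijOn.mapsTo trivial, rfl⟩,
    fun q q' hqq' => ?_, isEquivariant_iff_galConj.mpr fun τ q => ?_,
    fun p => congrArg (P.reduce ∘ S.η) (e.symm_apply_apply p).symm, hpres, ?_⟩
  · exact e.symm.injective (hη (hpres.injOn (Or.inl ⟨_, rfl⟩) (Or.inl ⟨_, rfl⟩) hqq'))
  · exact hequiv τ _ _ (by rw [he, he])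
  · rw [← Set.range_comp]
    exact (e.symm.surjective.range_comp (P.reduce ∘ S.η)).symm

theorem SchemeOfLines.exists_hasGoodReductionAt [IsFractionRing (𝓞 K) K]
    [Algebra.IsAlgebraic ℤ Kbar] (hF : IsSmoothQuartic F Kbar) (S : SchemeOfLines F Kbar) :
    ∃ D : ℕ, 0 < D ∧ ∀ p : ℕ, p.Prime → ¬p ∣ D →
      ∀ (𝔭 : Ideal (𝓞 K)) [𝔭.IsMaximal], (p : 𝓞 K) ∈ 𝔭 → S.HasGoodReductionAt 𝔭 := by
  have := IsAlgClosure.isAlgClosed K (K := Kbar)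
  obtain ⟨M, θ, hθ⟩ := exists_integralModel_adjoin_eq_top (K := K) (B := S.B)
  obtain ⟨D, hD, h⟩ := exists_forall_of_eventually_almostAllPlaces
    ((M.eventually_isSmoothAt hθ).and
      ((eventually_quarticGoodReduction hF).and (S.eventually_exists_reduction hθ)))
  refine ⟨D, hD, fun p hp hpD 𝔭 _ hp𝔭 => ?_⟩
  obtain ⟨P₀⟩ := PlaceOver.nonempty (Kbar := Kbar) 𝔭
  refine ⟨M, (h p hp hpD 𝔭 P₀ hp𝔭).1, fun P => ?_⟩
  obtain ⟨-, hquartic, η', hmem, hinj, hequiv, hcomm, hpres, himage⟩ := h p hp hpD 𝔭 P hp𝔭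
  exact ⟨hquartic, η', hmem, hinj, hequiv, hcomm, hpres.exists_incidenceGraph_iso himage⟩

end GoodReductionAlmostEverywhere

end LinesOnQuartic

theorem mainTheorem7_general {K : Type*} [Field K] [CharZero K] [Algebra.IsAlgebraic ℚ K]
    {Kbar : Type*} [Field Kbar] [Algebra K Kbar] [IsAlgClosure K Kbar]
    (F : MvPolynomial (Fin 4) K) (hF : LinesOnQuartic.IsSmoothQuartic F Kbar) :
    Nonempty (LinesOnQuartic.SchemeOfLines F Kbar) ∧
    ∀ S : LinesOnQuartic.SchemeOfLines F Kbar,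
      ∃ D : ℕ, 0 < D ∧
        ∀ p : ℕ, p.Prime → ¬ p ∣ D →
          ∀ (𝔭 : Ideal (𝓞 K)) [𝔭.IsMaximal], (p : 𝓞 K) ∈ 𝔭 →
            S.HasGoodReductionAt 𝔭 := by
  have : Algebra.IsAlgebraic ℤ K := (IsFractionRing.comap_isAlgebraic_iff (K := ℚ)).mpr ‹_›
  have : IsFractionRing (𝓞 K) K := integralClosure.isFractionRing_of_algebraic
    ((injective_iff_map_eq_zero _).mp (algebraMap ℤ K).injective_int)
  have : Algebra.IsAlgebraic ℤ Kbar := Algebra.IsAlgebraic.trans ℤ K Kbar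
  exact ⟨LinesOnQuartic.exists_schemeOfLines hF, fun S => S.exists_hasGoodReductionAt hF⟩

theorem mainTheorem7 {K : Type*} [Field K] [NumberField K]
    {Kbar : Type*} [Field Kbar] [Algebra K Kbar] [IsAlgClosure K Kbar]
    (F : MvPolynomial (Fin 4) K) (hF : LinesOnQuartic.IsSmoothQuartic F Kbar) :
    Nonempty (LinesOnQuartic.SchemeOfLines F Kbar) ∧
    ∀ S : LinesOnQuartic.SchemeOfLines F Kbar,
      ∃ D : ℕ, 0 < D ∧
        ∀ p : ℕ, p.Prime → ¬ p ∣ D →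
          ∀ (𝔭 : Ideal (𝓞 K)) [𝔭.IsMaximal], (p : 𝓞 K) ∈ 𝔭 →
            S.HasGoodReductionAt 𝔭 :=
  mainTheorem7_general F hF
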